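/- Let $N\ge 2$ and let $D\subset\mathbb{R}^N$ be a bounded domain (open, connected, non-empty) with boundary of class $C^2$. A characterizing function for $D$ is a real-valued function $\lambda$ of class $C^2$ on an open neighbourhood of $\overline D$ such that $\lambda(x)<0$ if and only if $x\in D$, $\{x:\lambda(x)=0\}=\partial D$, and $|\nabla\lambda|>0$ on $\partial D$. Call $\varepsilon_\lambda>0$ admissible for $\lambda$ if there is $c>0$ with $|\nabla\lambda(x)|\ge c$ for all $x\in D$ with $-\varepsilon_\lambda<\lambda(x)<0$ (every sufficiently small $\varepsilon_\lambda>0$ is admissible). For $0<\varepsilon<\varepsilon_\lambda$ let $\sigma_\varepsilon^\lambda$ be the area measure ($(N-1)$-dimensional Hausdorff measure) on the level surface $\{x\in D:\lambda(x)=-\varepsilon\}$. For $1\le p\le\infty$ and $u$ harmonic (complex-valued) on $D$ put $$\|u\|_{h^p}^{\lambda}=\sup_{0<\varepsilon<\varepsilon_\lambda}\Big(\int_{\{\lambda=-\varepsilon\}}|u|^p\,d\sigma_\varepsilon^\lambda\Big)^{1/p},$$ where for $p=\infty$ the inner expression is the essential supremum of $|u|$ with respect to $\sigma^\lambda_\varepsilon$,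 and let $h^p(D)$ be the set of all $u$ harmonic on $D$ with $\|u\|_{h^p}^{\lambda}<\infty$. **Lemma 4.2 (Stein).** Let $\lambda_1,\lambda_2$ be two characterizing functions for $D$, and let $\varepsilon_{\lambda_1},\varepsilon_{\lambda_2}$ be any admissible numbers for them. Then for every $1\le p\le\infty$ and every harmonic function $u$ on $D$, $$\|u\|_{h^p}^{\lambda_1}<\infty\quad\Longleftrightarrow\quad\|u\|_{h^p}^{\lambda_2}<\infty .$$ Hence the space $h^p(D)$ does not depend on the choice of $\lambda$ (nor of the admissible $\varepsilon_\lambda$). -/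

import Mathlib

open MeasureTheory Set
open scoped ENNReal Gradient

noncomputable section

/-- `lam` is a characterizing function for `D ⊆ ℝ^N`: it is defined on an open neighbourhood `U` of
the closure of `D` (its values off `U` play no role), it is of class `C^2` there, it is negative
exactly on `D`, it vanishes exactly on `∂D`, and its gradient does not vanish on `∂D`. -/
structure IsCharacterizing {N : ℕ} (D : Set (EuclideanSpace ℝ (Fin N)))
    (lam : EuclideanSpace ℝ (Fin N) → ℝ) : Prop where
  exists_nhd : ∃ U : Set (EuclideanSpace ℝ (Fin N)), IsOpen U ∧ closure D ⊆ U ∧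
    ContDiffOn ℝ 2 lam U ∧ (∀ x ∈ U, lam x < 0 ↔ x ∈ D) ∧ (∀ x ∈ U, lam x = 0 ↔ x ∈ frontier D)
  gradient_pos : ∀ x ∈ frontier D, 0 < ‖∇ lam x‖

/-- `ε₀ > 0` is an admissible threshold for `lam`: the gradient of `lam` is bounded away from zero
on the union of the level surfaces `{lam = -ε}`, `0 < ε < ε₀`. -/
def IsAdmissibleLevel {N : ℕ} (D : Set (EuclideanSpace ℝ (Fin N)))
    (lam : EuclideanSpace ℝ (Fin N) → ℝ) (ε₀ : ℝ) : Prop :=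
  0 < ε₀ ∧ ∃ c : ℝ, 0 < c ∧ ∀ x ∈ D, -ε₀ < lam x → c ≤ ‖∇ lam x‖

/-- Every characterizing function of a bounded open set has admissible thresholds. -/
theorem exists_isAdmissibleLevel {N : ℕ} {D : Set (EuclideanSpace ℝ (Fin N))}
    {lam : EuclideanSpace ℝ (Fin N) → ℝ} (hb : Bornology.IsBounded D) (ho : IsOpen D)
    (h : IsCharacterizing D lam) : ∃ ε₀, IsAdmissibleLevel D lam ε₀ := by
  obtain ⟨⟨U, hU, hDU, hC, hneg, hz⟩, hg⟩ := h
  have hK : IsCompact (closure D) := hb.isCompact_closure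
  have hgc : ContinuousOn (fun x => ‖∇ lam x‖) (closure D) := by
    have : ContinuousOn (fun x => fderiv ℝ lam x) U := hC.continuousOn_fderiv_of_isOpen hU (by norm_num)
    have h2 : ContinuousOn (fun x => ∇ lam x) U := by
      unfold gradient
      exact (LinearIsometryEquiv.continuous _).comp_continuousOn this
    exact (h2.mono hDU).norm
  have hlc : ContinuousOn lam (closure D) := hC.continuousOn.mono hDU
  have hpos : ∀ x ∈ closure D, 0 < max ‖∇ lam x‖ (- lam x) := by
    intro x hx
    by_cases hxD : x ∈ D
    · exact lt_max_of_lt_right (by have := (hneg x (hDU hx)).2 hxD; linarith)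
    · exact lt_max_of_lt_left (hg x ⟨hx, by rwa [ho.interior_eq]⟩)
  rcases (closure D).eq_empty_or_nonempty with he | hne
  · have : D = ∅ := by simpa using he
    exact ⟨1, one_pos, 1, one_pos, by simp [this]⟩
  obtain ⟨x0, hx0, hmin⟩ := hK.exists_isMinOn hne (f := fun x => max ‖∇ lam x‖ (- lam x)) (ContinuousOn.sup hgc hlc.neg)
  have := hpos x0 hx0
  set m := max ‖∇ lam x0‖ (- lam x0) with hm
  refine ⟨m, this, m, this, fun x hx hl => ?_⟩
  have h3 := hmin (subset_closure hx)
  change m ≤ max ‖∇ lam x‖ (- lam x) at h3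
  rcases le_max_iff.1 h3 with h | h
  · exact h
  · exfalso; linarith

/-- The level surface `{lam = -ε}`; for `ε > 0` it lies in `D`. -/
def levelSurface {N : ℕ} (D : Set (EuclideanSpace ℝ (Fin N)))
    (lam : EuclideanSpace ℝ (Fin N) → ℝ) (ε : ℝ) : Set (EuclideanSpace ℝ (Fin N)) :=
  {x | x ∈ D ∧ lam x = -ε}

/-- The area measure on the level surface `{lam = -ε}`: the `(N-1)`-dimensional Hausdorff measure of
`ℝ^N`, with the normalization of Lebesgue measure, restricted to the surface. -/
def levelArea {N : ℕ} (D : Set (EuclideanSpace ℝ (Fin N)))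
    (lam : EuclideanSpace ℝ (Fin N) → ℝ) (ε : ℝ) : Measure (EuclideanSpace ℝ (Fin N)) :=
  (Measure.euclideanHausdorffMeasure (N - 1)).restrict (levelSurface D lam ε)

/-- `sup_{0 < ε < ε₀} (∫_{lam = -ε} |u|^p dσ_ε)^{1/p}`, with values in `[0, ∞]`; for `p = ∞` the
inner expression is the essential supremum of `|u|` with respect to `σ_ε`. -/
def hardyNorm {N : ℕ} (D : Set (EuclideanSpace ℝ (Fin N)))
    (lam : EuclideanSpace ℝ (Fin N) → ℝ) (ε₀ : ℝ) (p : ℝ≥0∞)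
    (u : EuclideanSpace ℝ (Fin N) → ℂ) : ℝ≥0∞ :=
  ⨆ ε ∈ Ioo (0 : ℝ) ε₀, eLpNorm u p (levelArea D lam ε)

/-- The harmonic Hardy space `h^p(D)`, as defined by means of `lam` and the threshold `ε₀`. Only the
values on `D` of a function matter. -/
def harmonicHardySpace {N : ℕ} (D : Set (EuclideanSpace ℝ (Fin N)))
    (lam : EuclideanSpace ℝ (Fin N) → ℝ) (ε₀ : ℝ) (p : ℝ≥0∞) :
    Set (EuclideanSpace ℝ (Fin N) → ℂ) :=
  {u | InnerProductSpace.HarmonicOnNhd u D ∧ hardyNorm D lam ε₀ p u < ∞}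

end

/-! Let `A` be the norm of `u` computed with the first characterizing function. Both functions are
comparable to the distance to the complement of `D`, since their gradients are bounded and do not
vanish on the boundary. So a ball of radius `r`, a small multiple of `ε`, centred on the second
function's level surface at height `-ε`, stays in `D` and inside a shell of width comparable to `ε`
for the first function.

For `p < ∞` the sub-mean value inequality bounds `|u(x)|^p` by a multiple of `r^{-N}` times the
integral of `|u|^p` over that ball. Integrate in `x` over the level surface and exchange the
integrals: each `z` in the shell is weighted by the surface area inside a ball of radius `r` about
`z`, which is at most a multiple of `r^{N-1}` (`exists_area_le`). What remains is `r^{-1}` times the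
integral of `|u|^p` over the shell, and half of the coarea formula (`exists_setLIntegral_le`) bounds
the latter by a multiple of `ε A^p`. The powers of `ε` cancel. Levels away from zero lie in a
compact subset of `D`, where `u` is bounded.

For `p = ∞` the coarea bound shows that the open subset of the shell where `|u| > A` has volume
zero, so it is empty. -/

/-! ### Coordinate projections. -/

/-- The projection of `ℝ^(m+1)` onto `ℝ^m` which forgets the `i`-th coordinate. -/
def eraseCoord {m : ℕ} (i : Fin (m + 1)) (x : EuclideanSpace ℝ (Fin (m + 1))) :
    EuclideanSpace ℝ (Fin m) :=
  WithLp.toLp 2 (i.removeNth x)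

theorem eraseCoord_sub {m : ℕ} (i : Fin (m + 1)) (x y : EuclideanSpace ℝ (Fin (m + 1))) :
    eraseCoord i (x - y) = eraseCoord i x - eraseCoord i y := by
  ext j; rfl

theorem norm_sq_eq_eraseCoord {m : ℕ} (i : Fin (m + 1)) (x : EuclideanSpace ℝ (Fin (m + 1))) :
    ‖x‖ ^ 2 = x i ^ 2 + ‖eraseCoord i x‖ ^ 2 := by
  rw [EuclideanSpace.norm_sq_eq, EuclideanSpace.norm_sq_eq, Fin.sum_univ_succAbove _ i]
  simp [eraseCoord, Fin.removeNth]

theorem norm_eraseCoord_le {m : ℕ} (i : Fin (m + 1)) (x : EuclideanSpace ℝ (Fin (m + 1))) :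
    ‖eraseCoord i x‖ ≤ ‖x‖ := by
  have := norm_sq_eq_eraseCoord i x
  exact abs_le_of_sq_le_sq' (by nlinarith [sq_nonneg (x i)]) (norm_nonneg _) |>.2

theorem lipschitzWith_eraseCoord {m : ℕ} (i : Fin (m + 1)) :
    LipschitzWith 1 (eraseCoord (m := m) i) :=
  LipschitzWith.of_dist_le_mul fun x y => by
    rw [dist_eq_norm, dist_eq_norm, ← eraseCoord_sub]
    simpa using norm_eraseCoord_le i (x - y)

theorem eraseCoord_add_smul_single {m : ℕ} (i : Fin (m + 1)) (x : EuclideanSpace ℝ (Fin (m + 1)))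
    (c : ℝ) : eraseCoord i (x + c • EuclideanSpace.single i (1 : ℝ)) = eraseCoord i x := by
  ext j
  simp [eraseCoord, Fin.removeNth]

theorem norm_sub_coord_smul_single {m : ℕ} (i : Fin (m + 1))
    (x : EuclideanSpace ℝ (Fin (m + 1))) :
    ‖x - x i • EuclideanSpace.single i (1 : ℝ)‖ = ‖eraseCoord i x‖ := by
  have h := norm_sq_eq_eraseCoord i (x - x i • EuclideanSpace.single i (1 : ℝ))
  rw [sub_eq_add_neg, ← neg_smul, eraseCoord_add_smul_single] at h
  rw [sub_eq_add_neg, ← neg_smul]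
  have h2 : (x + -x i • EuclideanSpace.single i (1 : ℝ)) i = 0 := by simp
  rw [h2] at h
  exact (sq_eq_sq₀ (norm_nonneg _) (norm_nonneg _)).1 (by simpa using h)

/-! ### Level sets as Lipschitz graphs, and their area in balls. -/

/-- A convex open set on which the level sets of `lam` are Lipschitz graphs over the coordinate
hyperplane `x i = 0`. -/
structure IsGraphPatch {m : ℕ} (lam : EuclideanSpace ℝ (Fin (m + 1)) → ℝ)
    (W : Set (EuclideanSpace ℝ (Fin (m + 1)))) (i : Fin (m + 1)) (κ M : ℝ) : Prop where
  isOpen : IsOpen W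
  convex : Convex ℝ W
  differentiableAt : ∀ x ∈ W, DifferentiableAt ℝ lam x
  pos : 0 < κ
  le_partial : ∀ x ∈ W, κ ≤ |fderiv ℝ lam x (EuclideanSpace.single i 1)|
  norm_fderiv_le : ∀ x ∈ W, ‖fderiv ℝ lam x‖ ≤ M

/-- Some partial derivative is nonzero at the point; by continuity it keeps half its size on a small
ball, where the full derivative also stays bounded. -/
theorem exists_isGraphPatch {m : ℕ} {lam : EuclideanSpace ℝ (Fin (m + 1)) → ℝ}
    {U : Set (EuclideanSpace ℝ (Fin (m + 1)))} (hU : IsOpen U) (hlam : ContDiffOn ℝ 1 lam U)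
    {x₀ : EuclideanSpace ℝ (Fin (m + 1))} (hx₀ : x₀ ∈ U) (h₀ : fderiv ℝ lam x₀ ≠ 0) :
    ∃ W i κ M, x₀ ∈ W ∧ IsGraphPatch lam W i κ M := by
  obtain ⟨i, hi⟩ : ∃ i, fderiv ℝ lam x₀ (EuclideanSpace.single i 1) ≠ 0 := by
    by_contra! h
    refine h₀ (ContinuousLinearMap.coe_injective
      ((EuclideanSpace.basisFun (Fin (m + 1)) ℝ).toBasis.ext fun i => ?_))
    simpa using h i
  have hc : ContinuousAt (fderiv ℝ lam) x₀ :=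
    (hlam.continuousOn_fderiv_of_isOpen hU (by norm_num)).continuousAt (hU.mem_nhds hx₀)
  have hc2 : ContinuousAt (fun x => |fderiv ℝ lam x (EuclideanSpace.single i 1)|) x₀ :=
    (hc.clm_apply continuousAt_const).abs
  have e1 := hc2.eventually (lt_mem_nhds (half_lt_self (abs_pos.2 hi)))
  have e2 := hc.norm.eventually (gt_mem_nhds (lt_add_one _))
  obtain ⟨r, hr, hball⟩ := Metric.eventually_nhds_iff_ball.1
    (e1.and (e2.and (hU.eventually_mem hx₀)))
  refine ⟨Metric.ball x₀ r, i, _, _, Metric.mem_ball_self hr, Metric.isOpen_ball, convex_ball _ _,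
    fun x hx => ?_, half_pos (abs_pos.2 hi), fun x hx => (hball x hx).1.le,
    fun x hx => (hball x hx).2.1.le⟩
  have hxU := (hball x hx).2.2
  exact (hlam.differentiableOn (by norm_num)).differentiableAt (hU.mem_nhds hxU)

namespace IsGraphPatch

variable {m : ℕ} {lam : EuclideanSpace ℝ (Fin (m + 1)) → ℝ}
  {W : Set (EuclideanSpace ℝ (Fin (m + 1)))} {i : Fin (m + 1)} {κ M : ℝ}

/-- By the mean value theorem the derivative at some point of the segment kills `x - y`. As the
`i`-th partial is at least `κ` in size there, the `i`-th component of `x - y` is controlled by the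
others. -/
theorem norm_sub_le (h : IsGraphPatch lam W i κ M) {x y : EuclideanSpace ℝ (Fin (m + 1))}
    (hx : x ∈ W) (hy : y ∈ W) (hxy : lam x = lam y) :
    ‖x - y‖ ≤ (1 + M / κ) * ‖eraseCoord i x - eraseCoord i y‖ := by
  obtain ⟨z, hz, he⟩ := domain_mvt (f := lam) (f' := fderiv ℝ lam)
    (fun x hx => (h.differentiableAt x hx).hasFDerivAt.hasFDerivWithinAt) h.convex hy hx
  have hzW : z ∈ W := h.convex.segment_subset hy hx hz
  rw [← eraseCoord_sub]
  rw [hxy, sub_self] at he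
  set v := x - y
  set w := v - v i • EuclideanSpace.single i (1 : ℝ) with hw
  have hv : v = w + v i • EuclideanSpace.single i (1 : ℝ) := by simp [hw]
  have hwn : ‖w‖ = ‖eraseCoord i v‖ := norm_sub_coord_smul_single i v
  have h1 : v i * fderiv ℝ lam z (EuclideanSpace.single i 1) = - fderiv ℝ lam z w := by
    rw [hv] at he
    simp only [map_add, map_smul, smul_eq_mul] at he
    linarith
  have h2 : κ * |v i| ≤ M * ‖w‖ := by
    calc κ * |v i| ≤ |fderiv ℝ lam z (EuclideanSpace.single i 1)| * |v i| := by
          gcongr; exact h.le_partial z hzW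
      _ = |fderiv ℝ lam z w| := by rw [← abs_mul, mul_comm, h1, abs_neg]
      _ ≤ ‖fderiv ℝ lam z‖ * ‖w‖ := (fderiv ℝ lam z).le_opNorm w
      _ ≤ M * ‖w‖ := by gcongr; exact h.norm_fderiv_le z hzW
  have h3 : |v i| ≤ M / κ * ‖w‖ := by
    rw [div_mul_eq_mul_div, le_div_iff₀ h.pos]; linarith
  calc ‖v‖ ≤ ‖w‖ + ‖v i • EuclideanSpace.single i (1 : ℝ)‖ := by
        conv_lhs => rw [hv]
        exact norm_add_le _ _
    _ = ‖w‖ + |v i| := by simp [norm_smul]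
    _ ≤ _ := by rw [← hwn]; linarith

theorem injOn_eraseCoord (h : IsGraphPatch lam W i κ M) (s : ℝ) :
    InjOn (eraseCoord i) (W ∩ lam ⁻¹' {s}) := fun x hx y hy hxy => by
  have := h.norm_sub_le hx.1 hy.1 (hx.2.trans hy.2.symm)
  rw [hxy, sub_self, norm_zero, mul_zero] at this
  exact sub_eq_zero.1 (norm_le_zero_iff.1 this)

theorem bound_nonneg (h : IsGraphPatch lam W i κ M) {x} (hx : x ∈ W) : 0 ≤ M :=
  (norm_nonneg _).trans (h.norm_fderiv_le x hx)

/-- Upper Ahlfors regularity of the level sets in a patch. -/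
theorem area_le (h : IsGraphPatch lam W i κ M) (s : ℝ) (y : EuclideanSpace ℝ (Fin (m + 1)))
    (r : ℝ) :
    Measure.euclideanHausdorffMeasure m (W ∩ lam ⁻¹' {s} ∩ Metric.ball y r) ≤
      ENNReal.ofReal (1 + M / κ) ^ m *
        volume (Metric.ball (0 : EuclideanSpace ℝ (Fin m)) r) := by
  set A := W ∩ lam ⁻¹' {s} ∩ Metric.ball y r with hA
  -- The projection is antilipschitz on the piece of level set, so its area is at most a constant
  -- times the Lebesgue measure of its shadow, which lies in a ball of radius `r`.
  have hanti : AntilipschitzWith (1 + M / κ).toNNReal (A.domRestrict (eraseCoord i)) := by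
    refine AntilipschitzWith.of_le_mul_dist fun a b => ?_
    have := h.norm_sub_le a.2.1.1 b.2.1.1 (a.2.1.2.trans b.2.1.2.symm)
    rw [Real.coe_toNNReal _ (by have := div_nonneg (h.bound_nonneg a.2.1.1) h.pos.le; linarith)]
    rw [Subtype.dist_eq, dist_eq_norm, dist_eq_norm]
    exact this
  have h1 := hanti.le_hausdorffMeasure_image (d := (m : ℝ)) (by positivity) univ
  have h2 : (Measure.euclideanHausdorffMeasure m : Measure A) univ ≤
      ENNReal.ofReal (1 + M / κ) ^ m * (Measure.euclideanHausdorffMeasure m)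
        (eraseCoord i '' A) := by
    simp only [Measure.euclideanHausdorffMeasure_def, Measure.smul_apply]
    rw [image_univ, range_domRestrict] at h1
    rw [ENNReal.smul_def, ENNReal.smul_def, smul_eq_mul, smul_eq_mul, mul_left_comm]
    gcongr
    rw [ENNReal.ofReal, ← ENNReal.rpow_natCast]
    exact h1
  rw [← isometry_subtype_coe.euclideanHausdorffMeasure_image, image_univ, Subtype.range_coe] at h2
  refine h2.trans ?_
  rw [EuclideanSpace.euclideanHausdorffMeasure_eq_volume]
  refine mul_le_mul_right ?_ _
  calc volume (eraseCoord i '' A) ≤ volume (Metric.ball (eraseCoord i y) r) := by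
        refine measure_mono ?_
        rintro _ ⟨x, hx, rfl⟩
        have h3 := (lipschitzWith_eraseCoord i).dist_le_mul x y
        have h4 : dist x y < r := hx.2
        simp only [NNReal.coe_one, one_mul] at h3
        exact Metric.mem_ball.2 (by linarith)
    _ = _ := Measure.addHaar_ball_center _ _ _

end IsGraphPatch

theorem EuclideanSpace.volume_ball_zero (m : ℕ) {r : ℝ} (hr : 0 < r) :
    volume (Metric.ball (0 : EuclideanSpace ℝ (Fin m)) r) =
      ENNReal.ofReal r ^ m * volume (Metric.ball (0 : EuclideanSpace ℝ (Fin m)) 1) := by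
  rw [Measure.addHaar_ball_of_pos _ _ hr, finrank_euclideanSpace_fin, ENNReal.ofReal_pow hr.le]

/-- Upper Ahlfors regularity of level sets, uniformly over a compact set of regular points. -/
theorem exists_area_le {m : ℕ} {lam : EuclideanSpace ℝ (Fin (m + 1)) → ℝ}
    {U K : Set (EuclideanSpace ℝ (Fin (m + 1)))} (hU : IsOpen U) (hlam : ContDiffOn ℝ 1 lam U)
    (hK : IsCompact K) (hKU : K ⊆ U) (hreg : ∀ x ∈ K, fderiv ℝ lam x ≠ 0) :
    ∃ C : ℝ≥0∞, C ≠ ∞ ∧ ∀ (s : ℝ) (y : EuclideanSpace ℝ (Fin (m + 1))) (r : ℝ), 0 < r →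
      Measure.euclideanHausdorffMeasure m (K ∩ lam ⁻¹' {s} ∩ Metric.ball y r) ≤
        C * ENNReal.ofReal r ^ m := by
  -- The property passes to subsets, and to unions by adding constants, so by compactness one patch
  -- around each point suffices.
  refine hK.induction_on (p := fun S => ∃ C : ℝ≥0∞, C ≠ ∞ ∧
    ∀ (s : ℝ) (y : EuclideanSpace ℝ (Fin (m + 1))) (r : ℝ), 0 < r →
      Measure.euclideanHausdorffMeasure m (S ∩ lam ⁻¹' {s} ∩ Metric.ball y r) ≤
        C * ENNReal.ofReal r ^ m) ⟨0, by simp, by simp⟩ ?_ ?_ ?_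
  · rintro S T hST ⟨C, hC, h⟩
    exact ⟨C, hC, fun s y r hr => (measure_mono (by gcongr)).trans (h s y r hr)⟩
  · rintro S T ⟨C, hC, h⟩ ⟨C', hC', h'⟩
    refine ⟨C + C', ENNReal.add_ne_top.2 ⟨hC, hC'⟩, fun s y r hr => ?_⟩
    rw [union_inter_distrib_right, union_inter_distrib_right, add_mul]
    exact (measure_union_le _ _).trans (add_le_add (h s y r hr) (h' s y r hr))
  · intro x hx
    obtain ⟨W, i, κ, M, hxW, hp⟩ := exists_isGraphPatch hU hlam (hKU hx) (hreg x hx)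
    refine ⟨W, mem_nhdsWithin_of_mem_nhds (hp.isOpen.mem_nhds hxW),
      ENNReal.ofReal (1 + M / κ) ^ m * volume (Metric.ball (0 : EuclideanSpace ℝ (Fin m)) 1), ?_,
      fun s y r hr => (hp.area_le s y r).trans_eq ?_⟩
    · exact ENNReal.mul_ne_top (by finiteness) measure_ball_lt_top.ne
    · rw [EuclideanSpace.volume_ball_zero m hr]; ring

/-! ### The coarea inequality. -/

theorem MeasurableSet.inter_preimage_of_continuousOn {α β : Type*} [TopologicalSpace α]
    [MeasurableSpace α] [OpensMeasurableSpace α] [TopologicalSpace β] [MeasurableSpace β]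
    [BorelSpace β] {f : α → β} {s : Set α} {t : Set β} (hs : MeasurableSet s)
    (hf : ContinuousOn f s) (ht : MeasurableSet t) : MeasurableSet (s ∩ f ⁻¹' t) := by
  have h := hs.subtype_image
    ((continuousOn_iff_continuous_domRestrict.1 hf).measurable ht)
  convert h using 1
  ext x
  simp [and_comm]

theorem LipschitzWith.euclideanHausdorffMeasure_image_le_of_one {X Y : Type*} [EMetricSpace X]
    [MeasurableSpace X] [BorelSpace X] [EMetricSpace Y] [MeasurableSpace Y] [BorelSpace Y]
    {f : X → Y} (hf : LipschitzWith 1 f) (d : ℕ) (s : Set X) :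
    Measure.euclideanHausdorffMeasure d (f '' s) ≤ Measure.euclideanHausdorffMeasure d s := by
  simp only [Measure.euclideanHausdorffMeasure_def, Measure.smul_apply]
  have := hf.hausdorffMeasure_image_le (d := (d : ℝ)) (by positivity) s
  gcongr
  simpa using this

/-- A 1-Lipschitz map does not increase Hausdorff measure, so the image of surface area under the
projection dominates Lebesgue measure on the shadow. Injectivity serves to make the shadow
measurable. -/
theorem lintegral_le_setLIntegral_comp_eraseCoord {m : ℕ} (i : Fin (m + 1))
    {A : Set (EuclideanSpace ℝ (Fin (m + 1)))} (hA : MeasurableSet A)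
    (hinj : InjOn (eraseCoord i) A) {h : EuclideanSpace ℝ (Fin m) → ℝ≥0∞} (hm : Measurable h)
    (h0 : ∀ z, z ∉ eraseCoord i '' A → h z = 0) :
    ∫⁻ z, h z ≤ ∫⁻ x in A, h (eraseCoord i x) ∂Measure.euclideanHausdorffMeasure m := by
  have hP : Measurable (eraseCoord (m := m) i) := (lipschitzWith_eraseCoord i).continuous.measurable
  have hPA : MeasurableSet (eraseCoord i '' A) :=
    hA.image_of_continuousOn_injOn (lipschitzWith_eraseCoord i).continuous.continuousOn hinj
  have hle : volume.restrict (eraseCoord i '' A) ≤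
      ((Measure.euclideanHausdorffMeasure m).restrict A).map (eraseCoord i) := by
    refine Measure.le_iff.2 fun S hS => ?_
    rw [Measure.restrict_apply hS, Measure.map_apply hP hS, Measure.restrict_apply (hP hS),
      ← EuclideanSpace.euclideanHausdorffMeasure_eq_volume, inter_comm S, ← image_inter_preimage,
      inter_comm A]
    exact (lipschitzWith_eraseCoord i).euclideanHausdorffMeasure_image_le_of_one _ _
  calc ∫⁻ z, h z = ∫⁻ z in eraseCoord i '' A, h z := by
        rw [← lintegral_indicator hPA]
        refine lintegral_congr fun z => ?_
        by_cases hz : z ∈ eraseCoord i '' A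
        · rw [indicator_of_mem hz]
        · rw [indicator_of_notMem hz, h0 z hz]
    _ ≤ ∫⁻ z, h z ∂(((Measure.euclideanHausdorffMeasure m).restrict A).map (eraseCoord i)) :=
        lintegral_mono' hle le_rfl
    _ = _ := lintegral_map hm hP

/-- The point with `i`-th coordinate `s` and remaining coordinates `z`. -/
def insertCoord {m : ℕ} (i : Fin (m + 1)) (s : ℝ) (z : EuclideanSpace ℝ (Fin m)) :
    EuclideanSpace ℝ (Fin (m + 1)) :=
  WithLp.toLp 2 (i.insertNth s z)

theorem measurable_insertCoord {m : ℕ} (i : Fin (m + 1)) :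
    Measurable fun p : ℝ × EuclideanSpace ℝ (Fin m) => insertCoord i p.1 p.2 := by
  have h1 := (MeasurableEquiv.piFinSuccAbove (fun _ : Fin (m + 1) => ℝ) i).symm.measurable
  have h2 : Measurable fun p : ℝ × EuclideanSpace ℝ (Fin m) => (p.1, (p.2 : Fin m → ℝ)) := by
    fun_prop
  exact (WithLp.measurable_toLp 2 _).comp (h1.comp h2)

theorem lintegral_eq_lintegral_insertCoord {m : ℕ} (i : Fin (m + 1))
    {g : EuclideanSpace ℝ (Fin (m + 1)) → ℝ≥0∞} (hg : Measurable g) :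
    ∫⁻ x, g x = ∫⁻ s : ℝ, ∫⁻ z : EuclideanSpace ℝ (Fin m), g (insertCoord i s z) := by
  have e1 := (PiLp.volume_preserving_toLp (Fin (m + 1))).lintegral_comp hg
  have e2 := ((volume_preserving_piFinSuccAbove (fun _ : Fin (m + 1) => ℝ) i).symm).lintegral_comp
    (hg.comp (WithLp.measurable_toLp 2 _))
  rw [← e1, show (∫⁻ a : Fin (m + 1) → ℝ, g (WithLp.toLp 2 a)) = _ from e2.symm,
    Measure.volume_eq_prod, lintegral_prod _ (by
      exact (hg.comp (WithLp.measurable_toLp 2 _)).comp (MeasurableEquiv.measurable _)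
        |>.aemeasurable)]
  refine lintegral_congr fun s => ?_
  have e3 := (PiLp.volume_preserving_toLp (Fin m)).lintegral_comp
    (hg.comp ((measurable_insertCoord i).comp (measurable_prodMk_left (x := s))))
  exact e3

theorem insertCoord_eraseCoord {m : ℕ} (i : Fin (m + 1)) (s : ℝ)
    (x : EuclideanSpace ℝ (Fin (m + 1))) :
    insertCoord i s (eraseCoord i x) = x + (s - x i) • EuclideanSpace.single i (1 : ℝ) := by
  ext j
  refine Fin.succAboveCases i ?_ (fun j => ?_) j <;> simp [insertCoord, eraseCoord]

theorem insertCoord_inj {m : ℕ} {i : Fin (m + 1)} {s t : ℝ} {z w : EuclideanSpace ℝ (Fin m)}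
    (h : insertCoord i s z = insertCoord i t w) : s = t ∧ z = w := by
  have h1 := (WithLp.toLp_injective 2 h)
  rw [Fin.insertNth_inj] at h1
  exact ⟨h1.1, WithLp.ofLp_injective 2 h1.2⟩

namespace IsGraphPatch

variable {m : ℕ} {lam : EuclideanSpace ℝ (Fin (m + 1)) → ℝ}
  {W : Set (EuclideanSpace ℝ (Fin (m + 1)))} {i : Fin (m + 1)} {κ M : ℝ}

theorem continuousOn (h : IsGraphPatch lam W i κ M) : ContinuousOn lam W := fun x hx =>
  (h.differentiableAt x hx).continuousAt.continuousWithinAt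

/-- One half of the coarea formula on a patch. -/
theorem setLIntegral_le (h : IsGraphPatch lam W i κ M)
    {f : EuclideanSpace ℝ (Fin (m + 1)) → ℝ≥0∞} (hf : Measurable f) {T : Set ℝ}
    (hT : MeasurableSet T) {A : ℝ≥0∞}
    (hA : ∀ s ∈ T, ∫⁻ x in W ∩ lam ⁻¹' {s}, f x ∂Measure.euclideanHausdorffMeasure m ≤ A) :
    ∫⁻ x in W ∩ lam ⁻¹' T, f x ≤ (ENNReal.ofReal κ)⁻¹ * (A * volume T) := by
  set S := W ∩ lam ⁻¹' T with hSdef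
  have hS : MeasurableSet S :=
    h.isOpen.measurableSet.inter_preimage_of_continuousOn h.continuousOn hT
  -- `Ψ` replaces the `i`-th coordinate by the value of `lam`, which straightens level sets into
  -- hyperplanes. The change of variables formula followed by Fubini then slices the integral by
  -- levels.
  set Ψ : EuclideanSpace ℝ (Fin (m + 1)) → EuclideanSpace ℝ (Fin (m + 1)) :=
    fun x => insertCoord i (lam x) (eraseCoord i x) with hΨ
  have hinj : InjOn Ψ S := fun x hx y hy hxy => by
    obtain ⟨h1, h2⟩ := insertCoord_inj hxy
    exact h.injOn_eraseCoord (lam y) ⟨hx.1, h1⟩ ⟨hy.1, rfl⟩ h2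
  set Ψ' : EuclideanSpace ℝ (Fin (m + 1)) →
      EuclideanSpace ℝ (Fin (m + 1)) →L[ℝ] EuclideanSpace ℝ (Fin (m + 1)) := fun x =>
    ContinuousLinearMap.id ℝ _ + (fderiv ℝ lam x - EuclideanSpace.proj i).smulRight
      (EuclideanSpace.single i (1 : ℝ)) with hΨ'
  have hder : ∀ x ∈ S, HasFDerivWithinAt Ψ (Ψ' x) S x := fun x hx => by
    have h1 := (h.differentiableAt x hx.1).hasFDerivAt
    have h2 := (hasFDerivAt_id x).add ((h1.sub (EuclideanSpace.proj (𝕜 := ℝ) i).hasFDerivAt).smul_const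
      (EuclideanSpace.single i (1 : ℝ)))
    refine HasFDerivAt.hasFDerivWithinAt ?_
    refine h2.congr_of_eventuallyEq (Filter.Eventually.of_forall fun y => ?_)
    simp [hΨ, insertCoord_eraseCoord]
  -- The derivative is a transvection, with determinant one plus the functional at the basis vector:
  -- `1 + (∂ᵢ lam - 1)`.
  have hdet : ∀ x, (Ψ' x).det = fderiv ℝ lam x (EuclideanSpace.single i 1) := fun x => by
    have : ((Ψ' x : EuclideanSpace ℝ (Fin (m + 1)) →L[ℝ] EuclideanSpace ℝ (Fin (m + 1))) :
        EuclideanSpace ℝ (Fin (m + 1)) →ₗ[ℝ] EuclideanSpace ℝ (Fin (m + 1))) =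
        LinearMap.transvection ((fderiv ℝ lam x - EuclideanSpace.proj i :
          EuclideanSpace ℝ (Fin (m + 1)) →L[ℝ] ℝ) : EuclideanSpace ℝ (Fin (m + 1)) →ₗ[ℝ] ℝ)
          (EuclideanSpace.single i (1 : ℝ)) := by
      ext y
      simp [hΨ', LinearMap.transvection]
    rw [ContinuousLinearMap.det, this, LinearMap.transvection.det]
    simp
  have hΨc : ContinuousOn Ψ S := fun x hx => (hder x hx).continuousWithinAt
  have hemb := hΨc.measurableEmbedding hS hinj
  -- `g` is `f` transported by `Ψ` and extended by zero off the image of `S`.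
  set g : EuclideanSpace ℝ (Fin (m + 1)) → ℝ≥0∞ :=
    Function.extend (S.domRestrict Ψ) (fun x => f x) 0 with hg
  have hgm : Measurable g :=
    hemb.measurable_extend (hf.comp measurable_subtype_coe) measurable_const
  have hgΨ : ∀ x ∈ S, g (Ψ x) = f x := fun x hx =>
    hemb.injective.extend_apply (fun x : S => f x) 0 ⟨x, hx⟩
  have hg0 : ∀ y, (∀ x ∈ S, Ψ x ≠ y) → g y = 0 := fun y hy =>
    Function.extend_apply' _ _ _ (by rintro ⟨x, hx⟩; exact hy x x.2 hx)
  have hlevel : ∀ s ∈ T, ∫⁻ z, g (insertCoord i s z) ≤ A := fun s hs => by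
    refine le_trans ?_ (hA s hs)
    have hAs : MeasurableSet (W ∩ lam ⁻¹' {s}) :=
      h.isOpen.measurableSet.inter_preimage_of_continuousOn h.continuousOn
        (measurableSet_singleton s)
    refine (lintegral_le_setLIntegral_comp_eraseCoord i hAs (h.injOn_eraseCoord s)
      (hgm.comp ((measurable_insertCoord i).comp (measurable_prodMk_left (x := s)))) ?_).trans_eq ?_
    · intro z hz
      refine hg0 _ fun x hx hxz => hz ?_
      obtain ⟨h1, h2⟩ := insertCoord_inj hxz
      exact ⟨x, ⟨hx.1, h1⟩, h2⟩
    · refine setLIntegral_congr_fun hAs fun x hx => ?_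
      have hxs : lam x = s := hx.2
      have := hgΨ x ⟨hx.1, by rw [mem_preimage, hxs]; exact hs⟩
      simpa [hΨ, hxs] using this
  have hκ0 : ENNReal.ofReal κ ≠ 0 := by simpa using h.pos
  rw [← ENNReal.div_eq_inv_mul, ENNReal.le_div_iff_mul_le (.inl hκ0) (.inl ENNReal.ofReal_ne_top),
    mul_comm]
  calc ENNReal.ofReal κ * ∫⁻ x in S, f x = ∫⁻ x in S, ENNReal.ofReal κ * f x :=
        (lintegral_const_mul _ hf).symm
    _ ≤ ∫⁻ x in S, ENNReal.ofReal |(Ψ' x).det| * g (Ψ x) := by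
        refine setLIntegral_mono' hS fun x hx => ?_
        rw [hgΨ x hx, hdet]
        gcongr
        exact h.le_partial x hx.1
    _ = ∫⁻ y in Ψ '' S, g y :=
        (lintegral_image_eq_lintegral_abs_det_fderiv_mul volume hS hder hinj g).symm
    _ ≤ ∫⁻ y, g y := setLIntegral_le_lintegral _ _
    _ = ∫⁻ s : ℝ, ∫⁻ z, g (insertCoord i s z) := lintegral_eq_lintegral_insertCoord i hgm
    _ ≤ ∫⁻ s : ℝ, T.indicator (fun _ => A) s := by
        refine lintegral_mono fun s => ?_
        by_cases hs : s ∈ T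
        · rw [indicator_of_mem hs]; exact hlevel s hs
        · rw [indicator_of_notMem hs, nonpos_iff_eq_zero]
          refine (lintegral_congr fun z => hg0 _ fun x hx hxz => hs ?_).trans lintegral_zero
          rw [← (insertCoord_inj hxz).1]
          exact hx.2
    _ = A * volume T := by rw [lintegral_indicator_const hT]

end IsGraphPatch

/-- One half of the coarea formula, up to a constant, near a compact set of regular points. -/
theorem exists_setLIntegral_le {m : ℕ} {lam : EuclideanSpace ℝ (Fin (m + 1)) → ℝ}
    {U K : Set (EuclideanSpace ℝ (Fin (m + 1)))} (hU : IsOpen U) (hlam : ContDiffOn ℝ 1 lam U)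
    (hK : IsCompact K) (hKU : K ⊆ U) (hreg : ∀ x ∈ K, fderiv ℝ lam x ≠ 0) :
    ∃ C : ℝ≥0∞, C ≠ ∞ ∧ ∀ f : EuclideanSpace ℝ (Fin (m + 1)) → ℝ≥0∞, Measurable f →
      ∀ T : Set ℝ, MeasurableSet T → ∀ A : ℝ≥0∞,
      (∀ s ∈ T, ∫⁻ x in U ∩ lam ⁻¹' {s}, f x ∂Measure.euclideanHausdorffMeasure m ≤ A) →
      ∫⁻ x in K ∩ lam ⁻¹' T, f x ≤ C * (A * volume T) := by
  refine hK.induction_on (p := fun S => ∃ C : ℝ≥0∞, C ≠ ∞ ∧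
      ∀ f : EuclideanSpace ℝ (Fin (m + 1)) → ℝ≥0∞, Measurable f →
      ∀ T : Set ℝ, MeasurableSet T → ∀ A : ℝ≥0∞,
      (∀ s ∈ T, ∫⁻ x in U ∩ lam ⁻¹' {s}, f x ∂Measure.euclideanHausdorffMeasure m ≤ A) →
      ∫⁻ x in S ∩ lam ⁻¹' T, f x ≤ C * (A * volume T)) ⟨0, by simp, by simp⟩ ?_ ?_ ?_
  · rintro S S' hS ⟨C, hC, h⟩
    exact ⟨C, hC, fun f hf T hT A hA =>
      (lintegral_mono_set (by gcongr)).trans (h f hf T hT A hA)⟩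
  · rintro S S' ⟨C, hC, h⟩ ⟨C', hC', h'⟩
    refine ⟨C + C', ENNReal.add_ne_top.2 ⟨hC, hC'⟩, fun f hf T hT A hA => ?_⟩
    rw [union_inter_distrib_right, add_mul]
    exact (lintegral_union_le _ _ _).trans (add_le_add (h f hf T hT A hA) (h' f hf T hT A hA))
  · intro x hx
    obtain ⟨W, i, κ, M, hxW, hp⟩ := exists_isGraphPatch hU hlam (hKU hx) (hreg x hx)
    -- The hypothesis only controls integrals over level sets inside `U`, so the patch is shrunk
    -- into `U`; a ball keeps it convex.
    obtain ⟨r, hr, hball⟩ := Metric.isOpen_iff.1 (hp.isOpen.inter hU) x ⟨hxW, hKU hx⟩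
    have hp' : IsGraphPatch lam (Metric.ball x r) i κ M :=
      { isOpen := Metric.isOpen_ball
        convex := convex_ball _ _
        differentiableAt := fun y hy => hp.differentiableAt y (hball hy).1
        pos := hp.pos
        le_partial := fun y hy => hp.le_partial y (hball hy).1
        norm_fderiv_le := fun y hy => hp.norm_fderiv_le y (hball hy).1 }
    refine ⟨Metric.ball x r, mem_nhdsWithin_of_mem_nhds (Metric.ball_mem_nhds x hr),
      (ENNReal.ofReal κ)⁻¹, by simpa using hp.pos, fun f hf T hT A hA =>
      hp'.setLIntegral_le hf hT fun s hs => (lintegral_mono_set ?_).trans (hA s hs)⟩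
    exact inter_subset_inter_left _ fun y hy => (hball hy).2

/-! ### Characterizing functions and the distance to the complement. -/

theorem norm_gradient_eq {F : Type*} [NormedAddCommGroup F] [InnerProductSpace ℝ F]
    [CompleteSpace F] (f : F → ℝ) (x : F) : ‖∇ f x‖ = ‖fderiv ℝ f x‖ := by
  simp [gradient]

namespace IsCharacterizing

variable {N : ℕ} {D : Set (EuclideanSpace ℝ (Fin N))} {lam : EuclideanSpace ℝ (Fin N) → ℝ}

theorem neg_of_mem (h : IsCharacterizing D lam) {x} (hx : x ∈ D) : lam x < 0 := by
  obtain ⟨U, hU, hDU, hC, hneg, hz⟩ := h.exists_nhd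
  exact (hneg x (hDU (subset_closure hx))).2 hx

theorem continuousOn_closure (h : IsCharacterizing D lam) : ContinuousOn lam (closure D) := by
  obtain ⟨U, hU, hDU, hC, hneg, hz⟩ := h.exists_nhd
  exact hC.continuousOn.mono hDU

theorem isCompact_sublevel (h : IsCharacterizing D lam) (hb : Bornology.IsBounded D) {δ : ℝ}
    (hδ : 0 < δ) : IsCompact {x | x ∈ D ∧ lam x ≤ -δ} := by
  have h1 : {x | x ∈ D ∧ lam x ≤ -δ} = closure D ∩ lam ⁻¹' Iic (-δ) := by
    obtain ⟨U, hU, hDU, hC, hneg, hz⟩ := h.exists_nhd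
    ext x
    refine ⟨fun hx => ⟨subset_closure hx.1, hx.2⟩, fun hx => ⟨(hneg x (hDU hx.1)).1 ?_, hx.2⟩⟩
    have : lam x ≤ -δ := hx.2
    linarith
  rw [h1]
  exact hb.isCompact_closure.of_isClosed_subset
    (h.continuousOn_closure.preimage_isClosed_of_isClosed isClosed_closure isClosed_Iic)
    inter_subset_left

/-- A characterizing function is controlled by the distance to the complement. -/
theorem exists_neg_le_infDist (h : IsCharacterizing D lam) (hb : Bornology.IsBounded D)
    (hD : D ≠ univ) :
    ∃ M : ℝ, 0 < M ∧ ∀ x ∈ D, -lam x ≤ M * Metric.infDist x Dᶜ := by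
  obtain ⟨U, hU, hDU, hC, hneg, hz⟩ := h.exists_nhd
  have hc : ContinuousOn (fderiv ℝ lam) (closure D) :=
    (hC.continuousOn_fderiv_of_isOpen hU (by norm_num)).mono hDU
  obtain ⟨M, hM⟩ := hb.isCompact_closure.exists_bound_of_continuousOn hc
  refine ⟨max M 1, by positivity, fun x hx => ?_⟩
  -- The mean value inequality is applied between `x` and a nearest boundary point `y`, where `lam`
  -- vanishes; the ball joining them lies in the closure of `D`.
  obtain ⟨y, hy, hxy⟩ := exists_mem_frontier_infDist_compl_eq_dist hx hD
  have hsub := Metric.closedBall_infDist_compl_subset_closure hx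
  have hmv := (convex_closedBall x (Metric.infDist x Dᶜ)).norm_image_sub_le_of_norm_fderiv_le
    (f := lam) (𝕜 := ℝ) (C := max M 1) (x := x) (y := y)
    (fun z hz => (hC.differentiableOn (by norm_num)).differentiableAt
      (hU.mem_nhds (hDU (hsub hz))))
    (fun z hz => (hM z (hsub hz)).trans (le_max_left _ _))
    (Metric.mem_closedBall_self Metric.infDist_nonneg)
    (by rw [Metric.mem_closedBall, dist_comm, hxy])
  rw [(hz y (hDU hy.1)).2 hy, zero_sub, norm_neg, ← dist_eq_norm, dist_comm y x, ← hxy] at hmv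
  exact (neg_le_abs _).trans hmv

/-- The distance to the complement is controlled by a characterizing function. -/
theorem exists_infDist_le (h : IsCharacterizing D lam) (hb : Bornology.IsBounded D)
    (ho : IsOpen D) :
    ∃ C : ℝ, 0 < C ∧ ∀ x ∈ D, Metric.infDist x Dᶜ ≤ C * -lam x := by
  suffices hs : ∃ C : ℝ, 0 < C ∧ ∀ x ∈ D, x ∈ closure D → Metric.infDist x Dᶜ ≤ C * -lam x by
    obtain ⟨C, hC, h⟩ := hs
    exact ⟨C, hC, fun x hx => h x hx (subset_closure hx)⟩
  refine hb.isCompact_closure.induction_on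
    (p := fun S => ∃ C : ℝ, 0 < C ∧ ∀ x ∈ D, x ∈ S → Metric.infDist x Dᶜ ≤ C * -lam x)
    ⟨1, one_pos, by simp⟩ ?_ ?_ ?_
  · rintro S T hST ⟨C, hC, h⟩
    exact ⟨C, hC, fun x hx hxS => h x hx (hST hxS)⟩
  · rintro S T ⟨C, hC, h1⟩ ⟨C', hC', h2⟩
    refine ⟨max C C', by positivity, fun x hx hxS => ?_⟩
    have h0 : 0 ≤ -lam x := by have := h.neg_of_mem hx; linarith
    rcases hxS with hxS | hxS
    · exact (h1 x hx hxS).trans (by gcongr; exact le_max_left _ _)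
    · exact (h2 x hx hxS).trans (by gcongr; exact le_max_right _ _)
  · intro x₀ hx₀
    obtain ⟨U, hU, hDU, hC, hneg, hz⟩ := h.exists_nhd
    by_cases hxD : x₀ ∈ D
    · have hl := h.neg_of_mem hxD
      have hc : ContinuousAt lam x₀ := hC.continuousOn.continuousAt (hU.mem_nhds (hDU hx₀))
      have e1 := hc.eventually (gt_mem_nhds (show lam x₀ < lam x₀ / 2 by linarith))
      have e2 := (Metric.continuous_infDist_pt (Dᶜ)).continuousAt (x := x₀) |>.eventually
        (gt_mem_nhds (lt_add_one _))
      have hd := Metric.infDist_nonneg (x := x₀) (s := Dᶜ)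
      have hC0 : 0 < (Metric.infDist x₀ Dᶜ + 1) / (-lam x₀ / 2) :=
        div_pos (by linarith) (by linarith)
      refine ⟨_, mem_nhdsWithin_of_mem_nhds (e1.and e2), _, hC0, fun x hx hxS => ?_⟩
      obtain ⟨h1, h2⟩ := hxS
      calc Metric.infDist x Dᶜ ≤ Metric.infDist x₀ Dᶜ + 1 := h2.le
        _ = (Metric.infDist x₀ Dᶜ + 1) / (-lam x₀ / 2) * (-lam x₀ / 2) := by
          rw [div_mul_cancel₀]; linarith
        _ ≤ _ := by gcongr ?_ * ?_; linarith
    · have hfr : x₀ ∈ frontier D := ⟨hx₀, by rwa [ho.interior_eq]⟩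
      have hg := h.gradient_pos x₀ hfr
      rw [norm_gradient_eq] at hg
      -- Near a boundary point, `lam` grows at rate at least `κ` along `v`, so a walk of time `-lam
      -- x / κ` from `x` leaves `D`.
      obtain ⟨v, hv⟩ : ∃ v, 0 < fderiv ℝ lam x₀ v := by
        by_contra! hcon
        refine (norm_pos_iff.1 hg) (ContinuousLinearMap.ext fun v => le_antisymm (hcon v) ?_)
        have := hcon (-v)
        simp only [map_neg] at this
        simpa using this
      set κ := fderiv ℝ lam x₀ v / 2 with hκdef
      have hκ : 0 < κ := half_pos hv
      have hv0 : 0 < ‖v‖ := norm_pos_iff.2 (by rintro rfl; simp at hv)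
      have hc : ContinuousAt (fun x => fderiv ℝ lam x v) x₀ :=
        ((hC.continuousOn_fderiv_of_isOpen hU (by norm_num)).continuousAt
          (hU.mem_nhds (hDU hx₀))).clm_apply continuousAt_const
      have e1 := hc.eventually (lt_mem_nhds (half_lt_self hv))
      obtain ⟨r, hr, hball⟩ := Metric.eventually_nhds_iff_ball.1
        (e1.and (hU.eventually_mem (hDU hx₀)))
      refine ⟨Metric.ball x₀ (r / 2), mem_nhdsWithin_of_mem_nhds
        (Metric.ball_mem_nhds x₀ (half_pos hr)), ‖v‖ / κ, div_pos hv0 hκ, fun x hx hxS => ?_⟩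
      have hl := h.neg_of_mem hx
      set t := -lam x / κ with ht
      have ht0 : 0 < t := div_pos (by linarith) hκ
      have hteq : ‖v‖ / κ * -lam x = t * ‖v‖ := by rw [ht]; ring
      rw [hteq]
      rw [Metric.mem_ball] at hxS
      -- If the walk might leave the ball where the rate is valid, then `x₀` itself, which is not in
      -- `D`, is already close enough.
      by_cases htr : r / 2 ≤ t * ‖v‖
      · exact (Metric.infDist_le_dist_of_mem hxD).trans (hxS.le.trans htr)
      · push Not at htr
        have hyball : x + t • v ∈ Metric.ball x₀ r := by
          rw [Metric.mem_ball]
          calc dist (x + t • v) x₀ ≤ dist (x + t • v) x + dist x x₀ := dist_triangle _ _ _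
            _ < r := by
              rw [dist_eq_norm, add_sub_cancel_left, norm_smul, Real.norm_of_nonneg ht0.le]
              linarith
        have hxball : x ∈ Metric.ball x₀ r := Metric.mem_ball.2 (by linarith)
        obtain ⟨z, hz', he⟩ := domain_mvt (f := lam) (f' := fderiv ℝ lam)
          (fun y hy => ((hC.differentiableOn (by norm_num)).differentiableAt
            (hU.mem_nhds (hball y hy).2)).hasFDerivAt.hasFDerivWithinAt)
          (convex_ball x₀ r) hxball hyball
        have hzb := hball z ((convex_ball x₀ r).segment_subset hxball hyball hz')
        rw [add_sub_cancel_left, map_smul, smul_eq_mul] at he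
        have h1 : t * κ ≤ t * fderiv ℝ lam z v := by gcongr; exact hzb.1.le
        have h2 : t * κ = -lam x := div_mul_cancel₀ _ hκ.ne'
        have hnot : x + t • v ∈ Dᶜ := fun hmem => by
          have := h.neg_of_mem hmem
          linarith
        refine (Metric.infDist_le_dist_of_mem hnot).trans_eq ?_
        rw [dist_eq_norm, sub_add_cancel_left, norm_neg, norm_smul, Real.norm_of_nonneg ht0.le]

/-- The closure of the union of the admissible level surfaces consists of regular points. -/
theorem fderiv_ne_zero_of_mem_closure (h : IsCharacterizing D lam) {ε₀ : ℝ}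
    (hε : IsAdmissibleLevel D lam ε₀) {x : EuclideanSpace ℝ (Fin N)}
    (hx : x ∈ closure {x | x ∈ D ∧ -ε₀ < lam x}) : fderiv ℝ lam x ≠ 0 := by
  obtain ⟨U, hU, hDU, hC, hneg, hz⟩ := h.exists_nhd
  obtain ⟨-, c, hc, hle⟩ := hε
  have hxU : x ∈ U := hDU (closure_mono (fun y hy => hy.1) hx)
  have hcont : ContinuousAt (fun y => ‖fderiv ℝ lam y‖) x :=
    ((hC.continuousOn_fderiv_of_isOpen hU (by norm_num)).continuousAt (hU.mem_nhds hxU)).norm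
  have hcx : c ≤ ‖fderiv ℝ lam x‖ := by
    by_contra! hlt
    obtain ⟨y, hy1, hy2⟩ := mem_closure_iff_nhds.1 hx _ (hcont.eventually (gt_mem_nhds hlt))
    have h3 := hle y hy2.1 hy2.2
    rw [norm_gradient_eq] at h3
    exact absurd h3 (not_le.2 hy1)
  exact norm_pos_iff.1 (hc.trans_le hcx)

end IsCharacterizing

/-! ### A smooth mean value property and the sub-mean value inequality. -/

/-- The cube makes the truncated potential differentiable across the unit sphere too. -/
theorem hasDerivAt_max_zero_pow_three (s : ℝ) :
    HasDerivAt (fun s : ℝ => max 0 s ^ 3) (3 * max 0 s ^ 2) s := by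
  rcases lt_trichotomy s 0 with hs | rfl | hs
  · have : (fun s : ℝ => max 0 s ^ 3) =ᶠ[nhds s] fun _ => 0 := by
      filter_upwards [gt_mem_nhds hs] with t ht
      simp [max_eq_left ht.le]
    rw [max_eq_left hs.le]
    simpa using (hasDerivAt_const s (0 : ℝ)).congr_of_eventuallyEq this
  · rw [hasDerivAt_iff_tendsto_slope_zero]
    have h0 : Filter.Tendsto (fun t : ℝ => |t| ^ 2) (nhdsWithin 0 {0}ᶜ) (nhds 0) := by
      have : Filter.Tendsto (fun t : ℝ => |t| ^ 2) (nhds 0) (nhds (|0| ^ 2)) :=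
        (continuous_abs.pow 2).tendsto 0
      simpa using this.mono_left nhdsWithin_le_nhds
    simp only [zero_add, max_self, ne_eq, OfNat.ofNat_ne_zero, not_false_eq_true, zero_pow,
      sub_zero, smul_eq_mul, mul_zero]
    refine squeeze_zero_norm' ?_ h0
    filter_upwards [self_mem_nhdsWithin] with t ht
    have h1 : |max 0 t| ≤ |t| := by
      rw [abs_of_nonneg (le_max_left _ _)]; exact max_le (abs_nonneg _) (le_abs_self _)
    have h2 : 0 < |t| := abs_pos.2 ht
    rw [norm_mul, norm_inv, norm_pow, Real.norm_eq_abs, Real.norm_eq_abs]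
    calc |t|⁻¹ * |max 0 t| ^ 3 ≤ |t|⁻¹ * |t| ^ 3 := by gcongr
      _ = |t| ^ 2 := by field_simp
  · have : (fun s : ℝ => max 0 s ^ 3) =ᶠ[nhds s] fun t => t ^ 3 := by
      filter_upwards [lt_mem_nhds hs] with t ht
      simp [max_eq_right ht.le]
    rw [max_eq_right hs.le]
    simpa using (hasDerivAt_pow 3 s).congr_of_eventuallyEq this

section MeanValue

variable {E : Type*} [NormedAddCommGroup E]

/-- A radial weight supported in the unit ball. -/
noncomputable def radialWeight (y : E) : ℝ := max 0 (1 - ‖y‖ ^ 2) ^ 2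

/-- A potential of the vector field `y ↦ radialWeight y • y`. -/
noncomputable def radialPotential (y : E) : ℝ := -(max 0 (1 - ‖y‖ ^ 2) ^ 3 / 6)

theorem continuous_radialWeight : Continuous (radialWeight (E := E)) := by
  unfold radialWeight; fun_prop

theorem continuous_radialPotential : Continuous (radialPotential (E := E)) := by
  unfold radialPotential; fun_prop

theorem radialWeight_nonneg (y : E) : 0 ≤ radialWeight y := by
  unfold radialWeight; positivity

theorem radialWeight_le_one (y : E) : radialWeight y ≤ 1 := by
  unfold radialWeight
  exact pow_le_one₀ (le_max_left _ _) (max_le zero_le_one (by nlinarith [sq_nonneg ‖y‖]))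

theorem max_zero_one_sub_norm_sq {y : E} (hy : 1 ≤ ‖y‖) : max 0 (1 - ‖y‖ ^ 2) = 0 :=
  max_eq_left (by nlinarith)

theorem radialWeight_eq_zero {y : E} (hy : 1 ≤ ‖y‖) : radialWeight y = 0 := by
  simp [radialWeight, max_zero_one_sub_norm_sq hy]

theorem radialPotential_eq_zero {y : E} (hy : 1 ≤ ‖y‖) : radialPotential y = 0 := by
  simp [radialPotential, max_zero_one_sub_norm_sq hy]

variable [InnerProductSpace ℝ E]

theorem hasFDerivAt_radialPotential (y : E) :
    HasFDerivAt radialPotential (radialWeight y • innerSL ℝ y) y := by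
  have h1 : HasFDerivAt (fun y : E => 1 - ‖y‖ ^ 2) (-((2 : ℕ) • innerSL ℝ y)) y :=
    (hasStrictFDerivAt_norm_sq y).hasFDerivAt.const_sub 1
  have h2 := (((hasDerivAt_max_zero_pow_three (1 - ‖y‖ ^ 2)).div_const 6).neg).comp_hasFDerivAt y h1
  refine h2.congr_fderiv ?_
  ext v
  simp [radialWeight]
  ring

variable [FiniteDimensional ℝ E]

theorem hasCompactSupport_radialWeight : HasCompactSupport (radialWeight (E := E)) :=
  HasCompactSupport.intro (isCompact_closedBall (0 : E) 1) fun y hy =>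
    radialWeight_eq_zero (by simpa using (not_le.1 (by simpa using hy)).le)

theorem hasCompactSupport_radialPotential : HasCompactSupport (radialPotential (E := E)) :=
  HasCompactSupport.intro (isCompact_closedBall (0 : E) 1) fun y hy =>
    radialPotential_eq_zero (by simpa using (not_le.1 (by simpa using hy)).le)

variable [MeasurableSpace E] [BorelSpace E]

theorem integral_radialWeight_pos : 0 < ∫ y : E, radialWeight y :=
  continuous_radialWeight.integral_pos_of_hasCompactSupport_nonneg_nonzero
    hasCompactSupport_radialWeight radialWeight_nonneg (x := 0) (by simp [radialWeight])

variable {F : Type*} [NormedAddCommGroup F] [NormedSpace ℝ F]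

open InnerProductSpace in
-- The field `radialWeight y • y` is the gradient of `radialPotential`, so integration by parts
-- turns the integral into `-t` times that of the potential against the Laplacian of `w`. This
-- vanishes: the Laplacian is zero where the potential is not.
theorem integral_radialWeight_smul_fderiv {w : E → F} (hw : ContDiff ℝ 2 w) (x : E) (t : ℝ)
    (hΔ : ∀ y : E, ‖y‖ < 1 → Laplacian.laplacian w (x + t • y) = 0) :
    ∫ y : E, radialWeight y • fderiv ℝ w (x + t • y) y = 0 := by
  set b := stdOrthonormalBasis ℝ E
  have hw1 : ContDiff ℝ 1 (fderiv ℝ w) := hw.fderiv_right (by norm_num)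
  have hc1 : Continuous (fderiv ℝ w) := hw1.continuous
  have hc2 : Continuous (fderiv ℝ (fderiv ℝ w)) := hw1.continuous_fderiv (by norm_num)
  have hd : ∀ (e y : E), HasFDerivAt (fun y => fderiv ℝ w (x + t • y) e)
      ((ContinuousLinearMap.apply ℝ F e).comp
        ((fderiv ℝ (fderiv ℝ w) (x + t • y)).comp (t • ContinuousLinearMap.id ℝ E))) y := by
    intro e y
    have h1 : HasFDerivAt (fun y : E => x + t • y) (t • ContinuousLinearMap.id ℝ E) y :=
      ((hasFDerivAt_id y).const_smul t).const_add x
    have h2 := ((hw1.differentiable (by norm_num)) (x + t • y)).hasFDerivAt.comp y h1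
    exact (ContinuousLinearMap.apply ℝ F e).hasFDerivAt.comp y h2
  have hint : ∀ (c : E → ℝ) (G : E → F), Continuous c → HasCompactSupport c → Continuous G →
      Integrable (fun y => c y • G y) := fun c G hc hs hG =>
    (hc.smul hG).integrable_of_hasCompactSupport hs.smul_right
  have hdw : ∀ i, HasCompactSupport fun y : E => radialWeight y * inner ℝ y (b i) := fun i =>
    hasCompactSupport_radialWeight.mul_right
  have hcw : ∀ i, Continuous fun y : E => radialWeight y * inner ℝ y (b i) := fun i =>
    continuous_radialWeight.mul (by fun_prop)
  have hparts : ∀ i, ∫ y : E, (radialWeight y * inner ℝ y (b i)) • fderiv ℝ w (x + t • y) (b i) =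
      - ∫ y : E, t • radialPotential y • fderiv ℝ (fderiv ℝ w) (x + t • y) (b i) (b i) := by
    intro i
    have h := integral_bilinear_hasFDerivAt_right_eq_neg_left_of_integrable
      (μ := (volume : Measure E)) (f := radialPotential (E := E))
      (g := fun y => fderiv ℝ w (x + t • y) (b i)) (v := b i)
      (B := ContinuousLinearMap.lsmul ℝ ℝ)
      (f' := fun y => radialWeight y • innerSL ℝ y)
      (g' := fun y => (ContinuousLinearMap.apply ℝ F (b i)).comp
        ((fderiv ℝ (fderiv ℝ w) (x + t • y)).comp (t • ContinuousLinearMap.id ℝ E)))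
      (by
        simpa using! hint _ (fun y => fderiv ℝ w (x + t • y) (b i)) (hcw i) (hdw i) (by fun_prop))
      (by
        simpa using! (hint _ (fun y => fderiv ℝ (fderiv ℝ w) (x + t • y) (b i) (b i))
          continuous_radialPotential hasCompactSupport_radialPotential (by fun_prop)).smul t)
      (by
        simpa using! hint _ (fun y => fderiv ℝ w (x + t • y) (b i))
          continuous_radialPotential hasCompactSupport_radialPotential (by fun_prop))
      (fun y _ => hasFDerivAt_radialPotential y) (fun y _ => hd _ y)
    simp at h
    rw [eq_neg_iff_add_eq_zero, add_comm, ← eq_neg_iff_add_eq_zero]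
    simpa using! h
  have hsum : ∀ y : E, radialWeight y • fderiv ℝ w (x + t • y) y =
      ∑ i, (radialWeight y * inner ℝ y (b i)) • fderiv ℝ w (x + t • y) (b i) := fun y => by
    have h1 : fderiv ℝ w (x + t • y) y =
        fderiv ℝ w (x + t • y) (∑ i, b.repr y i • b i) := by rw [b.sum_repr y]
    rw [h1, map_sum, Finset.smul_sum]
    refine Finset.sum_congr rfl fun i _ => ?_
    rw [map_smul, smul_smul, b.repr_apply_apply, real_inner_comm]
  simp_rw [hsum]
  rw [integral_finsetSum _ fun i _ => hint _ _ (hcw i) (hdw i) (by fun_prop)]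
  simp_rw [hparts]
  have hi : ∀ i, Integrable fun y : E =>
      t • radialPotential y • fderiv ℝ (fderiv ℝ w) (x + t • y) (b i) (b i) := fun i =>
    (hint _ (fun y => fderiv ℝ (fderiv ℝ w) (x + t • y) (b i) (b i)) continuous_radialPotential
      hasCompactSupport_radialPotential (by fun_prop)).smul t
  rw [Finset.sum_neg_distrib, ← integral_finsetSum _ fun i _ => hi i]
  rw [neg_eq_zero]
  refine (integral_congr_ae (Filter.Eventually.of_forall fun y => ?_)).trans (integral_zero _ _)
  rw [← Finset.smul_sum, ← Finset.smul_sum]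
  by_cases hy : ‖y‖ < 1
  · have := hΔ y hy
    rw [laplacian_eq_iteratedFDeriv_orthonormalBasis w b] at this
    simp only [iteratedFDeriv_two_apply, Matrix.cons_val_zero, Matrix.cons_val_one] at this
    rw [this, smul_zero, smul_zero]
  · rw [radialPotential_eq_zero (not_lt.1 hy), zero_smul, smul_zero]

/-- The mean value property, with a smooth radial weight. -/
theorem integral_radialWeight_smul_eq [CompleteSpace F] {w : E → F} (hw : ContDiff ℝ 2 w)
    (hsupp : HasCompactSupport w) (x : E) {ρ : ℝ} (hρ : 0 ≤ ρ)
    (hΔ : ∀ z ∈ Metric.ball x ρ, Laplacian.laplacian w z = 0) :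
    ∫ y : E, radialWeight y • w (x + ρ • y) = (∫ y : E, radialWeight y) • w x := by
  obtain ⟨M, hM⟩ := (hsupp.fderiv (𝕜 := ℝ)).exists_bound_of_continuous
    (hw.continuous_fderiv (by norm_num))
  have hwc := hw.continuous
  have hfc : Continuous (fderiv ℝ w) := hw.continuous_fderiv (by norm_num)
  -- The weighted mean over the ball of radius `t` has zero derivative in `t`, hence equals its
  -- value at `t = 0`.
  have hder : ∀ t : ℝ, HasDerivAt (fun t : ℝ => ∫ y : E, radialWeight y • w (x + t • y))
      (∫ y : E, radialWeight y • fderiv ℝ w (x + t • y) y) t := by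
    intro t
    refine (hasDerivAt_integral_of_dominated_loc_of_deriv_le (μ := (volume : Measure E))
      (F := fun (t : ℝ) y => radialWeight y • w (x + t • y))
      (F' := fun (t : ℝ) y => radialWeight y • fderiv ℝ w (x + t • y) y) (x₀ := t)
      (s := univ) (bound := fun y => radialWeight y * (M * ‖y‖))
      Filter.univ_mem ?_ ?_ ?_ ?_ ?_ ?_).2
    · exact Filter.Eventually.of_forall fun s =>
        (continuous_radialWeight.smul (by fun_prop)).aestronglyMeasurable
    · exact (continuous_radialWeight.smul (by fun_prop)).integrable_of_hasCompactSupport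
        hasCompactSupport_radialWeight.smul_right
    · exact (continuous_radialWeight.smul (by fun_prop)).aestronglyMeasurable
    · refine Filter.Eventually.of_forall fun y s _ => ?_
      rw [norm_smul, Real.norm_of_nonneg (radialWeight_nonneg y)]
      gcongr
      · exact radialWeight_nonneg y
      · exact (ContinuousLinearMap.le_opNorm _ _).trans (by gcongr; exact hM _)
    · exact (continuous_radialWeight.mul (by fun_prop)).integrable_of_hasCompactSupport
        hasCompactSupport_radialWeight.mul_right
    · refine Filter.Eventually.of_forall fun y s _ => ?_
      have h1 : HasDerivAt (fun s : ℝ => x + s • y) y s := by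
        simpa using ((hasDerivAt_id s).smul_const y).const_add x
      exact (((hw.differentiable (by norm_num)) _).hasFDerivAt.comp_hasDerivAt s h1).const_smul _
  have hconst := constant_of_has_deriv_right_zero
    (f := fun t : ℝ => ∫ y : E, radialWeight y • w (x + t • y)) (a := 0) (b := ρ)
    (fun t _ => (hder t).continuousAt.continuousWithinAt) (fun t ht => ?_) ρ ⟨hρ, le_rfl⟩
  · rw [hconst]
    simp [integral_smul_const]
  · rw [← integral_radialWeight_smul_fderiv hw x t fun y hy => hΔ _ ?_]
    · exact (hder t).hasDerivWithinAt
    · rw [Metric.mem_ball, dist_eq_norm, add_sub_cancel_left, norm_smul, Real.norm_of_nonneg ht.1]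
      have h0 := ht.1
      have h1 := ht.2
      nlinarith [norm_nonneg y]

/-- A bump function equal to 1 on the ball of radius `r` and supported within radius `3r/2` replaces
`u` by a compactly supported `C²` function on the whole space, to which the mean value property
applies. -/
theorem enorm_le_lintegral_of_harmonicOnNhd [CompleteSpace F] {u : E → F} {x : E} {r : ℝ}
    (hr : 0 < r) (hu : InnerProductSpace.HarmonicOnNhd u (Metric.ball x (2 * r))) :
    ‖u x‖ₑ ≤ (ENNReal.ofReal (∫ y : E, radialWeight y))⁻¹ *
      ∫⁻ y in Metric.ball (0 : E) 1, ‖u (x + r • y)‖ₑ := by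
  let χ : ContDiffBump x := ⟨r, 3 / 2 * r, hr, by linarith⟩
  set w : E → F := fun y => χ y • u y with hwdef
  have hts : tsupport (χ : E → ℝ) ⊆ Metric.ball x (2 * r) := by
    rw [χ.tsupport_eq]
    exact Metric.closedBall_subset_ball (by change 3 / 2 * r < 2 * r; linarith)
  have hw : ContDiff ℝ 2 w := contDiff_iff_contDiffAt.2 fun y => by
    by_cases hy : y ∈ tsupport (χ : E → ℝ)
    · exact χ.contDiffAt.smul (hu y (hts hy)).1
    · have : w =ᶠ[nhds y] fun _ => 0 := by
        filter_upwards [(notMem_tsupport_iff_eventuallyEq.1 hy)] with z hz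
        simp [hwdef, hz]
      exact contDiffAt_const.congr_of_eventuallyEq this
  have hsupp : HasCompactSupport w := χ.hasCompactSupport.smul_right
  have hwu : ∀ z ∈ Metric.ball x r, w z = u z := fun z hz => by
    have : χ z = 1 := χ.one_of_mem_closedBall (Metric.ball_subset_closedBall hz)
    simp [hwdef, this]
  have hΔ : ∀ z ∈ Metric.ball x r, Laplacian.laplacian w z = 0 := fun z hz => by
    have h1 : w =ᶠ[nhds z] u := by
      filter_upwards [Metric.isOpen_ball.mem_nhds hz] with z' hz' using hwu z' hz'
    rw [(InnerProductSpace.laplacian_congr_nhds h1).eq_of_nhds]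
    exact (hu z (Metric.ball_subset_ball (by linarith) hz)).2.eq_of_nhds
  have hmv := integral_radialWeight_smul_eq hw hsupp x hr.le hΔ
  rw [hwu x (Metric.mem_ball_self hr)] at hmv
  have hI := integral_radialWeight_pos (E := E)
  rw [← ENNReal.div_eq_inv_mul, ENNReal.le_div_iff_mul_le (.inl (by simpa using hI))
    (.inl ENNReal.ofReal_ne_top), mul_comm]
  calc ENNReal.ofReal (∫ y : E, radialWeight y) * ‖u x‖ₑ
      = ‖(∫ y : E, radialWeight y) • u x‖ₑ := by
        rw [enorm_smul, Real.enorm_of_nonneg hI.le]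
    _ = ‖∫ y : E, radialWeight y • w (x + r • y)‖ₑ := by rw [hmv]
    _ ≤ ∫⁻ y : E, ‖radialWeight y • w (x + r • y)‖ₑ := enorm_integral_le_lintegral_enorm _
    _ ≤ ∫⁻ y : E, (Metric.ball (0 : E) 1).indicator (fun y => ‖u (x + r • y)‖ₑ) y := by
        refine lintegral_mono fun y => ?_
        by_cases hy : ‖y‖ < 1
        · rw [indicator_of_mem (by simpa using hy), enorm_smul]
          rw [hwu (x + r • y) (by
            rw [Metric.mem_ball, dist_eq_norm, add_sub_cancel_left, norm_smul,
              Real.norm_of_nonneg hr.le]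
            nlinarith)]
          refine mul_le_of_le_one_left' ?_
          rw [Real.enorm_of_nonneg (radialWeight_nonneg y)]
          exact ENNReal.ofReal_le_one.2 (radialWeight_le_one y)
        · rw [radialWeight_eq_zero (not_lt.1 hy)]
          simp
    _ = _ := lintegral_indicator measurableSet_ball _

/-- The `L^p` sub-mean value inequality for harmonic functions, up to a constant. -/
theorem exists_enorm_rpow_le_lintegral_of_harmonicOnNhd [CompleteSpace F] {q : ℝ} (hq : 1 ≤ q) :
    ∃ C : ℝ≥0∞, C ≠ ∞ ∧ ∀ (u : E → F) (x : E) (r : ℝ), 0 < r →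
      InnerProductSpace.HarmonicOnNhd u (Metric.ball x (2 * r)) →
      ‖u x‖ₑ ^ q ≤ C * ∫⁻ y in Metric.ball (0 : E) 1, ‖u (x + r • y)‖ₑ ^ q := by
  have hq0 : 0 < q := by linarith
  set V : ℝ≥0∞ := volume (Metric.ball (0 : E) 1)
  have hV : V ≠ ∞ := measure_ball_lt_top.ne
  have hI := integral_radialWeight_pos (E := E)
  refine ⟨((ENNReal.ofReal (∫ y : E, radialWeight y))⁻¹ * V ^ (1 - 1 / q)) ^ q, ?_,
    fun u x r hr hu => ?_⟩
  · refine ENNReal.rpow_ne_top_of_nonneg hq0.le (ENNReal.mul_ne_top (by simpa using hI)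
      (ENNReal.rpow_ne_top_of_nonneg ?_ hV))
    rw [sub_nonneg]; exact (div_le_one hq0).2 hq
  · have hcont : ContinuousOn (fun y : E => u (x + r • y)) (Metric.ball 0 1) := by
      refine hu.continuousOn.comp (by fun_prop) fun y hy => ?_
      have hy' : ‖y‖ < 1 := by simpa using hy
      rw [Metric.mem_ball, dist_eq_norm, add_sub_cancel_left, norm_smul, Real.norm_of_nonneg hr.le]
      nlinarith
    have h1 := enorm_le_lintegral_of_harmonicOnNhd hr hu
    -- Hölder on the unit ball passes from exponent 1 to `q`, so subharmonicity of `|u|^q` is not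
    -- needed.
    have h2 := eLpNorm_le_eLpNorm_mul_rpow_measure_univ (p := 1) (q := ENNReal.ofReal q)
      (by simpa using ENNReal.ofReal_le_ofReal hq)
      (hcont.aestronglyMeasurable (μ := volume) measurableSet_ball)
    rw [eLpNorm_one_eq_lintegral_enorm, Measure.restrict_apply_univ,
      eLpNorm_eq_lintegral_rpow_enorm_toReal (by simpa using hq0) ENNReal.ofReal_ne_top,
      ENNReal.toReal_ofReal hq0.le, ENNReal.toReal_one, div_one] at h2
    calc ‖u x‖ₑ ^ q ≤ ((ENNReal.ofReal (∫ y : E, radialWeight y))⁻¹ *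
          ((∫⁻ y in Metric.ball (0 : E) 1, ‖u (x + r • y)‖ₑ ^ q) ^ (1 / q) * V ^ (1 - 1 / q))) ^ q := by
          gcongr
          exact h1.trans (by gcongr)
      _ = ((ENNReal.ofReal (∫ y : E, radialWeight y))⁻¹ * V ^ (1 - 1 / q)) ^ q *
          ((∫⁻ y in Metric.ball (0 : E) 1, ‖u (x + r • y)‖ₑ ^ q) ^ (1 / q)) ^ q := by
          rw [← ENNReal.mul_rpow_of_nonneg _ _ hq0.le]
          congr 1; ring
      _ = _ := by rw [← ENNReal.rpow_mul, one_div_mul_cancel hq0.ne', ENNReal.rpow_one]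

end MeanValue

theorem setLIntegral_ball_comp_add_smul {E : Type*} [NormedAddCommGroup E] [InnerProductSpace ℝ E]
    [FiniteDimensional ℝ E] [MeasurableSpace E] [BorelSpace E] {g : E → ℝ≥0∞} (hg : Measurable g)
    (x : E) {r : ℝ} (hr : 0 < r) :
    ∫⁻ y in Metric.ball (0 : E) 1, g (x + r • y) =
      (ENNReal.ofReal r ^ Module.finrank ℝ E)⁻¹ * ∫⁻ z in Metric.ball x r, g z := by
  set G : E → ℝ≥0∞ := (Metric.ball x r).indicator g
  have hG : Measurable G := hg.indicator measurableSet_ball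
  have h1 : ∀ y : E, (Metric.ball (0 : E) 1).indicator (fun y => g (x + r • y)) y =
      G (x + r • y) := fun y => by
    have : y ∈ Metric.ball (0 : E) 1 ↔ x + r • y ∈ Metric.ball x r := by
      rw [Metric.mem_ball, Metric.mem_ball, dist_eq_norm, dist_eq_norm, add_sub_cancel_left,
        norm_smul, Real.norm_of_nonneg hr.le, sub_zero, mul_lt_iff_lt_one_right hr]
    by_cases hy : y ∈ Metric.ball (0 : E) 1
    · exact (indicator_of_mem hy _).trans (indicator_of_mem (this.1 hy) g).symm
    · exact (indicator_of_notMem hy _).trans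
        (indicator_of_notMem (fun h => hy (this.2 h)) g).symm
  rw [← lintegral_indicator measurableSet_ball, ← lintegral_indicator measurableSet_ball]
  simp_rw [h1]
  have h2 : ∫⁻ y : E, G (x + r • y) =
      ∫⁻ z, G (x + z) ∂(Measure.map (fun y : E => r • y) volume) := by
    rw [lintegral_map (by fun_prop) (by fun_prop)]
  rw [h2, Measure.map_addHaar_smul _ hr.ne', lintegral_smul_measure, lintegral_add_left_eq_self,
    abs_of_nonneg (by positivity), ENNReal.ofReal_inv_of_pos (by positivity),
    ENNReal.ofReal_pow hr.le, smul_eq_mul]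

/-! ### Comparison of the Hardy norms. -/

section Levels

variable {m : ℕ} {D : Set (EuclideanSpace ℝ (Fin (m + 1)))}
  {lam : EuclideanSpace ℝ (Fin (m + 1)) → ℝ} {ε₀ : ℝ}

theorem IsCharacterizing.measurableSet_levelSurface (h : IsCharacterizing D lam) (ho : IsOpen D)
    (ε : ℝ) : MeasurableSet (levelSurface D lam ε) :=
  ho.measurableSet.inter_preimage_of_continuousOn (h.continuousOn_closure.mono subset_closure)
    (measurableSet_singleton (-ε))

theorem IsCharacterizing.exists_levelArea_ball_le (h : IsCharacterizing D lam)
    (hb : Bornology.IsBounded D) (hε : IsAdmissibleLevel D lam ε₀) :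
    ∃ C : ℝ≥0∞, C ≠ ∞ ∧ ∀ ε ∈ Ioo 0 ε₀, ∀ (y : EuclideanSpace ℝ (Fin (m + 1))) (r : ℝ), 0 < r →
      levelArea D lam ε (Metric.ball y r) ≤ C * ENNReal.ofReal r ^ m := by
  obtain ⟨U, hU, hDU, hC, -, -⟩ := h.exists_nhd
  have hsub : closure {x | x ∈ D ∧ -ε₀ < lam x} ⊆ closure D := closure_mono fun x hx => hx.1
  obtain ⟨C, hC0, hle⟩ := exists_area_le hU (hC.of_le (by norm_num))
    (hb.isCompact_closure.of_isClosed_subset isClosed_closure hsub) (hsub.trans hDU)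
    (fun x hx => h.fderiv_ne_zero_of_mem_closure hε hx)
  refine ⟨C, hC0, fun ε hε y r hr => le_trans ?_ (hle (-ε) y r hr)⟩
  rw [levelArea, Measure.restrict_apply measurableSet_ball, Nat.add_sub_cancel]
  refine measure_mono fun x hx => ⟨⟨subset_closure ⟨hx.2.1, ?_⟩, hx.2.2⟩, hx.1⟩
  rw [hx.2.2]
  exact neg_lt_neg hε.2

theorem IsCharacterizing.exists_levelArea_univ_le (h : IsCharacterizing D lam)
    (hb : Bornology.IsBounded D) (hε : IsAdmissibleLevel D lam ε₀) :
    ∃ C : ℝ≥0∞, C ≠ ∞ ∧ ∀ ε ∈ Ioo 0 ε₀, levelArea D lam ε univ ≤ C := by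
  obtain ⟨C, hC, hle⟩ := h.exists_levelArea_ball_le hb hε
  obtain ⟨R, hR, hDR⟩ := hb.subset_ball_lt 0 0
  refine ⟨_, ENNReal.mul_ne_top hC (ENNReal.pow_ne_top ENNReal.ofReal_ne_top (n := m)),
    fun ε hε => le_trans ?_ (hle ε hε 0 R hR)⟩
  rw [levelArea, Measure.restrict_apply_univ, Measure.restrict_apply measurableSet_ball]
  exact measure_mono fun x hx => ⟨hDR hx.1, hx⟩

theorem IsCharacterizing.exists_setLIntegral_shell_le (h : IsCharacterizing D lam)
    (hb : Bornology.IsBounded D) (ho : IsOpen D) (hε : IsAdmissibleLevel D lam ε₀) :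
    ∃ C : ℝ≥0∞, C ≠ ∞ ∧ ∀ f : EuclideanSpace ℝ (Fin (m + 1)) → ℝ≥0∞, Measurable f →
      ∀ b ≤ ε₀, ∀ A : ℝ≥0∞, (∀ ε ∈ Ioo 0 b, ∫⁻ x, f x ∂levelArea D lam ε ≤ A) →
        ∫⁻ x in {x | x ∈ D ∧ -b < lam x}, f x ≤ C * (A * ENNReal.ofReal b) := by
  obtain ⟨U, hU, hDU, hC, -, -⟩ := h.exists_nhd
  have hsub : closure {x | x ∈ D ∧ -ε₀ < lam x} ⊆ closure D := closure_mono fun x hx => hx.1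
  obtain ⟨C, hC0, hle⟩ := exists_setLIntegral_le hU (hC.of_le (by norm_num))
    (hb.isCompact_closure.of_isClosed_subset isClosed_closure hsub) (hsub.trans hDU)
    (fun x hx => h.fderiv_ne_zero_of_mem_closure hε hx)
  refine ⟨C, hC0, fun f hf b hbε A hA => ?_⟩
  -- Cutting `f` off outside `D` turns integrals over level sets in `U` into integrals over level
  -- surfaces in `D`.
  have h1 := hle (D.indicator f) (hf.indicator ho.measurableSet) (Ioo (-b) 0) measurableSet_Ioo A
    fun s hs => ?_
  · rw [setLIntegral_indicator ho.measurableSet, Real.volume_Ioo, zero_sub, neg_neg] at h1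
    refine (lintegral_mono_set ?_).trans h1
    exact fun x hx => ⟨hx.1, subset_closure ⟨hx.1, (neg_le_neg hbε).trans_lt hx.2⟩, hx.2,
      h.neg_of_mem hx.1⟩
  · rw [setLIntegral_indicator ho.measurableSet]
    refine le_trans ?_ (hA (-s) ⟨neg_pos.2 hs.2, neg_lt.1 hs.1⟩)
    rw [levelArea, Nat.add_sub_cancel]
    exact lintegral_mono_set fun x hx => ⟨hx.1, by rw [neg_neg]; exact hx.2.2⟩

theorem ContinuousOn.measurable_indicator_enorm_rpow {E F : Type*} [TopologicalSpace E]
    [MeasurableSpace E] [OpensMeasurableSpace E] [NormedAddCommGroup F] {u : E → F} {s : Set E}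
    (hu : ContinuousOn u s) (hs : MeasurableSet s) (q : ℝ) :
    Measurable (s.indicator fun x => ‖u x‖ₑ ^ q) := by
  refine measurable_of_restrict_of_restrict_compl hs ?_ ?_
  · have h1 : Measurable fun x : s => ‖u x‖ₑ ^ q :=
      (continuousOn_iff_continuous_domRestrict.1 hu).enorm.measurable.pow_const q
    convert h1 using 1
    ext x
    simp
  · convert measurable_const (a := (0 : ℝ≥0∞)) using 1
    ext x
    exact indicator_of_notMem x.2 _

variable {lam₂ : EuclideanSpace ℝ (Fin (m + 1)) → ℝ} {ε₂ : ℝ}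
  {u : EuclideanSpace ℝ (Fin (m + 1)) → ℂ}

/-- The level surfaces have uniformly bounded area. The set `S` allows the bound on `u` to hold only
on levels away from zero. -/
theorem IsCharacterizing.exists_eLpNorm_le_of_bounded (h : IsCharacterizing D lam)
    (hb : Bornology.IsBounded D) (ho : IsOpen D) (hε : IsAdmissibleLevel D lam ε₀) (p : ℝ≥0∞)
    {S : Set ℝ} {B : ℝ} (hB : ∀ ε ∈ S, ∀ x ∈ levelSurface D lam ε, ‖u x‖ ≤ B) :
    ∃ C : ℝ≥0∞, C ≠ ∞ ∧ ∀ ε ∈ Ioo 0 ε₀ ∩ S, eLpNorm u p (levelArea D lam ε) ≤ C := by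
  obtain ⟨C, hC, hle⟩ := h.exists_levelArea_univ_le hb hε
  refine ⟨C ^ p.toReal⁻¹ * ENNReal.ofReal B, ENNReal.mul_ne_top
    (ENNReal.rpow_ne_top_of_nonneg (by positivity) hC) ENNReal.ofReal_ne_top, fun ε hεS => ?_⟩
  refine (eLpNorm_le_of_ae_bound (C := B) ?_).trans ?_
  · exact (ae_restrict_iff' (h.measurableSet_levelSurface ho ε)).2
      (Filter.Eventually.of_forall fun x hx => hB ε hεS.2 x hx)
  · gcongr
    exact hle ε hεS.1

theorem hardyNorm_top_lt_top (ho : IsOpen D) (hb : Bornology.IsBounded D)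
    (h : IsCharacterizing D lam) (h₂ : IsCharacterizing D lam₂)
    (hε : IsAdmissibleLevel D lam ε₀) (hε₂ : IsAdmissibleLevel D lam₂ ε₂)
    (hu : ContinuousOn u D) (hfin : hardyNorm D lam ε₀ ∞ u < ∞) :
    hardyNorm D lam₂ ε₂ ∞ u < ∞ := by
  set A := hardyNorm D lam ε₀ ∞ u with hA
  set V : Set (EuclideanSpace ℝ (Fin (m + 1))) := {x | x ∈ D ∧ A < ‖u x‖ₑ} with hV
  have hVo : IsOpen V := hu.enorm.isOpen_inter_preimage ho isOpen_Ioi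
  set Sh : Set (EuclideanSpace ℝ (Fin (m + 1))) := {x | x ∈ D ∧ -ε₀ < lam x} with hSh
  have hSho : IsOpen Sh :=
    (h.continuousOn_closure.mono subset_closure).isOpen_inter_preimage ho isOpen_Ioi
  obtain ⟨C, hC, hle⟩ := h.exists_setLIntegral_shell_le hb ho hε
  -- Coarea with level bound 0: `V` is null on every level, so its part in the shell is null and
  -- open, hence empty. The essential bound becomes a pointwise one.
  have h0 := hle (V.indicator 1) (measurable_one.indicator hVo.measurableSet) ε₀ le_rfl 0
    fun ε hεI => ?_
  · rw [zero_mul, mul_zero, nonpos_iff_eq_zero, lintegral_indicator_one hVo.measurableSet,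
      Measure.restrict_apply hVo.measurableSet, (hVo.inter hSho).measure_eq_zero_iff volume] at h0
    obtain ⟨B, hB⟩ := (h.isCompact_sublevel hb hε.1).exists_bound_of_continuousOn
      (hu.mono fun x hx => hx.1)
    have hbound : ∀ x ∈ D, ‖u x‖ ≤ max A.toReal B := fun x hx => by
      by_cases hx2 : -ε₀ < lam x
      · refine le_max_of_le_left ?_
        have hnot : ¬ A < ‖u x‖ₑ := fun hlt => by
          have : x ∈ V ∩ Sh := ⟨⟨hx, hlt⟩, hx, hx2⟩
          rw [h0] at this
          exact this
        have := ENNReal.toReal_mono hfin.ne (not_lt.1 hnot)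
        simpa using this
      · exact le_max_of_le_right (hB x ⟨hx, not_lt.1 hx2⟩)
    obtain ⟨C', hC', hle'⟩ := h₂.exists_eLpNorm_le_of_bounded hb ho hε₂ ∞ (S := univ)
      fun ε _ x hx => hbound x hx.1
    exact (iSup₂_le fun ε hεI => hle' ε ⟨hεI, mem_univ _⟩).trans_lt hC'.lt_top
  · rw [nonpos_iff_eq_zero, lintegral_indicator_one hVo.measurableSet]
    have h1 : eLpNorm u ∞ (levelArea D lam ε) ≤ A :=
      le_iSup₂ (f := fun ε (_ : ε ∈ Ioo 0 ε₀) => eLpNorm u ∞ (levelArea D lam ε)) ε hεI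
    rw [eLpNorm_exponent_top] at h1
    have h2 := ae_le_eLpNormEssSup (f := u) (μ := levelArea D lam ε)
    refine measure_mono_null (fun x hx => ?_) (ae_iff.1 h2)
    exact not_le.2 (h1.trans_lt hx.2)

theorem hardyNorm_lt_top_of_ne_top (ho : IsOpen D) (hb : Bornology.IsBounded D)
    (h : IsCharacterizing D lam) (h₂ : IsCharacterizing D lam₂)
    (hε : IsAdmissibleLevel D lam ε₀) (hε₂ : IsAdmissibleLevel D lam₂ ε₂)
    (hu : InnerProductSpace.HarmonicOnNhd u D) {p : ℝ≥0∞} (hp : 1 ≤ p) (hp' : p ≠ ∞)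
    (hfin : hardyNorm D lam ε₀ p u < ∞) : hardyNorm D lam₂ ε₂ p u < ∞ := by
  set A := hardyNorm D lam ε₀ p u with hA
  set q := p.toReal with hq
  have hp0 : p ≠ 0 := (one_pos.trans_le hp).ne'
  have hq1 : 1 ≤ q := by simpa using ENNReal.toReal_mono hp' hp
  have hq0 : 0 < q := by linarith
  have huc : ContinuousOn u D := hu.continuousOn
  -- The complement must be nonempty, as `Metric.infDist` to the empty set is 0 by convention.
  have hDne : D ≠ univ := fun hD => NormedSpace.unbounded_univ ℝ _ (hD ▸ hb)
  set f := D.indicator fun x => ‖u x‖ₑ ^ q with hf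
  have hfm : Measurable f := huc.measurable_indicator_enorm_rpow ho.measurableSet q
  have hfle : ∀ x, f x ≤ ‖u x‖ₑ ^ q := fun x => indicator_le_self _ _ x
  have hfeq : ∀ x ∈ D, f x = ‖u x‖ₑ ^ q := fun x hx => indicator_of_mem hx _
  have hlev : ∀ ε ∈ Ioo 0 ε₀, ∫⁻ x, f x ∂levelArea D lam ε ≤ A ^ q := fun ε hεI => by
    have h1 : eLpNorm u p (levelArea D lam ε) ≤ A :=
      le_iSup₂ (f := fun ε (_ : ε ∈ Ioo 0 ε₀) => eLpNorm u p (levelArea D lam ε)) ε hεI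
    rw [eLpNorm_eq_lintegral_rpow_enorm_toReal hp0 hp'] at h1
    have h2 := ENNReal.rpow_le_rpow h1 hq0.le
    rw [← ENNReal.rpow_mul, one_div_mul_cancel hq0.ne', ENNReal.rpow_one] at h2
    exact (lintegral_mono hfle).trans h2
  obtain ⟨M₁, hM₁, hdist₁⟩ := h.exists_neg_le_infDist hb hDne
  obtain ⟨M₂, hM₂, hdist₂⟩ := h₂.exists_neg_le_infDist hb hDne
  obtain ⟨C₂, hC₂, hdist₂'⟩ := h₂.exists_infDist_le hb ho
  obtain ⟨CA, hCA, hArea⟩ := h₂.exists_levelArea_ball_le hb hε₂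
  obtain ⟨CT, hCT, hTot⟩ := h₂.exists_levelArea_univ_le hb hε₂
  obtain ⟨CB, hCB, hShell⟩ := h.exists_setLIntegral_shell_le hb ho hε
  obtain ⟨CH, hCH, hMean⟩ := exists_enorm_rpow_le_lintegral_of_harmonicOnNhd
    (E := EuclideanSpace ℝ (Fin (m + 1))) (F := ℂ) hq1
  -- Within `r = ε / (4 * M₂)` of the level `-ε` of `lam₂`, the distance to the complement is at
  -- most `C₂ * ε + r`, so `-lam` is at most `M₁ * (C₂ + 1 / (4 * M₂)) * ε`. The extra 1 makes this
  -- strictly less than `b * ε`, and `ε < δ` keeps the shell admissible.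
  set b := M₁ * (C₂ + 1 / (4 * M₂)) + 1 with hbdef
  have hb0 : 0 < b := by positivity
  set δ := ε₀ / b with hδ
  have hδ0 : 0 < δ := div_pos hε.1 hb0
  have hnear : ∀ ε ∈ Ioo 0 ε₂ ∩ Iio δ, ∫⁻ x, ‖u x‖ₑ ^ q ∂levelArea D lam₂ ε ≤
      CH * (CA * (CB * (A ^ q * ENNReal.ofReal (4 * M₂ * b)))) := by
    rintro ε ⟨hεI, hεδ⟩
    have hε0 : 0 < ε := hεI.1
    have hbε : b * ε ≤ ε₀ := by
      have : ε < ε₀ / b := hεδ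
      rw [lt_div_iff₀ hb0] at this
      linarith
    set r := ε / (4 * M₂) with hr
    have hr0 : 0 < r := by positivity
    have hrM : M₂ * r = ε / 4 := by rw [hr]; field_simp
    set Sh : Set (EuclideanSpace ℝ (Fin (m + 1))) := {x | x ∈ D ∧ -(b * ε) < lam x} with hSh
    have hShm : MeasurableSet Sh :=
      ho.measurableSet.inter_preimage_of_continuousOn
        (h.continuousOn_closure.mono subset_closure) measurableSet_Ioi
    have hfinite : IsFiniteMeasure (levelArea D lam₂ ε) := ⟨(hTot ε hεI).trans_lt hCT.lt_top⟩
    -- The choice of `r` leaves room `4 * r` around each point, more than the `2 * r` required by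
    -- the sub-mean value inequality.
    have hd : ∀ x ∈ levelSurface D lam₂ ε, 4 * r ≤ Metric.infDist x Dᶜ := fun x hx => by
      have h1 := hdist₂ x hx.1
      rw [hx.2, neg_neg] at h1
      by_contra! hlt
      have := mul_lt_mul_of_pos_left hlt hM₂
      linarith
    have hballD : ∀ x ∈ levelSurface D lam₂ ε, Metric.ball x (4 * r) ⊆ D := fun x hx =>
      (Metric.ball_subset_ball (hd x hx)).trans Metric.ball_infDist_compl_subset
    have hballSh : ∀ x ∈ levelSurface D lam₂ ε, Metric.ball x r ⊆ Sh := fun x hx y hy => by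
      have hyD : y ∈ D := hballD x hx (Metric.ball_subset_ball (by linarith) hy)
      refine ⟨hyD, ?_⟩
      have h1 := hdist₂' x hx.1
      rw [hx.2, neg_neg] at h1
      have h2 : Metric.infDist y Dᶜ ≤ Metric.infDist x Dᶜ + dist y x :=
        Metric.infDist_le_infDist_add_dist
      have h3 : dist y x < r := hy
      have h4 := hdist₁ y hyD
      have h5 : M₁ * Metric.infDist y Dᶜ ≤ M₁ * (C₂ * ε + r) := by gcongr; linarith
      have h6 : b * ε = M₁ * (C₂ * ε + r) + ε := by rw [hbdef, hr]; ring
      linarith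
    -- The ball is recentred at `z`, so that after Fubini the inner integral is the area of the
    -- surface inside a ball about `z`.
    have hpoint : ∀ x ∈ levelSurface D lam₂ ε, ‖u x‖ₑ ^ q ≤
        CH * ((ENNReal.ofReal r ^ (m + 1))⁻¹ *
          ∫⁻ z in Sh, (Metric.ball z r).indicator (fun _ => f z) x) := fun x hx => by
      refine (hMean u x r hr0 fun y hy =>
        hu y (hballD x hx (Metric.ball_subset_ball (by linarith) hy))).trans ?_
      have h1 : ∫⁻ y in Metric.ball (0 : EuclideanSpace ℝ (Fin (m + 1))) 1, ‖u (x + r • y)‖ₑ ^ q =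
          ∫⁻ y in Metric.ball (0 : EuclideanSpace ℝ (Fin (m + 1))) 1, f (x + r • y) := by
        refine setLIntegral_congr_fun measurableSet_ball fun y hy => (hfeq _ ?_).symm
        refine hballD x hx ?_
        have hy' : ‖y‖ < 1 := by simpa using hy
        rw [Metric.mem_ball, dist_eq_norm, add_sub_cancel_left, norm_smul,
          Real.norm_of_nonneg hr0.le]
        nlinarith
      rw [h1, setLIntegral_ball_comp_add_smul hfm x hr0, finrank_euclideanSpace_fin]
      refine mul_le_mul_right (mul_le_mul_right ?_ _) _
      calc ∫⁻ z in Metric.ball x r, f z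
          = ∫⁻ z in Sh ∩ Metric.ball x r, f z := by
            rw [inter_eq_right.2 (hballSh x hx)]
        _ = ∫⁻ z in Sh, (Metric.ball x r).indicator f z := by
            rw [setLIntegral_indicator measurableSet_ball, inter_comm]
        _ ≤ _ := by
            refine lintegral_mono fun z => ?_
            by_cases hz : z ∈ Metric.ball x r
            · rw [indicator_of_mem hz, indicator_of_mem (Metric.mem_ball_comm.1 hz)]
            · rw [indicator_of_notMem hz]; exact zero_le
    have hmeas : Measurable (Function.uncurry fun x z : EuclideanSpace ℝ (Fin (m + 1)) =>
        (Metric.ball z r).indicator (fun _ => f z) x) := by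
      have h1 : MeasurableSet {w : EuclideanSpace ℝ (Fin (m + 1)) × EuclideanSpace ℝ (Fin (m + 1)) |
          dist w.1 w.2 < r} := (isOpen_lt continuous_dist continuous_const).measurableSet
      exact (hfm.comp measurable_snd).indicator h1
    -- The volume factor, the area factor and the shell width combine to `b * ε / r`, which does not
    -- depend on `ε`.
    have hcancel : (ENNReal.ofReal r ^ (m + 1))⁻¹ * (ENNReal.ofReal r ^ m *
        ENNReal.ofReal (b * ε)) = ENNReal.ofReal (4 * M₂ * b) := by
      rw [← ENNReal.ofReal_pow hr0.le, ← ENNReal.ofReal_pow hr0.le,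
        ← ENNReal.ofReal_inv_of_pos (by positivity), ← ENNReal.ofReal_mul (by positivity),
        ← ENNReal.ofReal_mul (by positivity)]
      congr 1
      have hεr : ε = 4 * M₂ * r := by linarith
      rw [hεr]
      field_simp
      ring
    calc ∫⁻ x, ‖u x‖ₑ ^ q ∂levelArea D lam₂ ε
        ≤ ∫⁻ x, CH * ((ENNReal.ofReal r ^ (m + 1))⁻¹ *
          ∫⁻ z in Sh, (Metric.ball z r).indicator (fun _ => f z) x) ∂levelArea D lam₂ ε :=
          setLIntegral_mono' (h₂.measurableSet_levelSurface ho ε) hpoint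
      _ = CH * ((ENNReal.ofReal r ^ (m + 1))⁻¹ * ∫⁻ x,
          (∫⁻ z in Sh, (Metric.ball z r).indicator (fun _ => f z) x) ∂levelArea D lam₂ ε) := by
          rw [lintegral_const_mul' _ _ hCH, lintegral_const_mul' _ _ (by simp [hr0])]
      _ = CH * ((ENNReal.ofReal r ^ (m + 1))⁻¹ * ∫⁻ z in Sh,
          (∫⁻ x, (Metric.ball z r).indicator (fun _ => f z) x ∂levelArea D lam₂ ε)) := by
          rw [lintegral_lintegral_swap hmeas.aemeasurable]
      _ ≤ CH * ((ENNReal.ofReal r ^ (m + 1))⁻¹ * ∫⁻ z in Sh,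
          (CA * ENNReal.ofReal r ^ m) * f z) := by
          gcongr with z
          rw [lintegral_indicator_const measurableSet_ball, mul_comm]
          gcongr
          exact hArea ε hεI z r hr0
      _ = CH * ((ENNReal.ofReal r ^ (m + 1))⁻¹ * ((CA * ENNReal.ofReal r ^ m) *
          ∫⁻ z in Sh, f z)) := by rw [lintegral_const_mul _ hfm]
      _ ≤ CH * ((ENNReal.ofReal r ^ (m + 1))⁻¹ * ((CA * ENNReal.ofReal r ^ m) *
          (CB * (A ^ q * ENNReal.ofReal (b * ε))))) := by
          gcongr
          exact hShell f hfm (b * ε) hbε _ fun ε' hε' => hlev ε' ⟨hε'.1, hε'.2.trans_le hbε⟩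
      _ = CH * (CA * (CB * (A ^ q * ((ENNReal.ofReal r ^ (m + 1))⁻¹ * (ENNReal.ofReal r ^ m *
          ENNReal.ofReal (b * ε)))))) := by ring
      _ = _ := by rw [hcancel]
  obtain ⟨B, hB⟩ := (h₂.isCompact_sublevel hb hδ0).exists_bound_of_continuousOn
    (huc.mono fun x hx => hx.1)
  obtain ⟨C', hC', hfar⟩ := h₂.exists_eLpNorm_le_of_bounded (u := u) hb ho hε₂ p (S := Ici δ)
    fun ε hεδ x hx => hB x ⟨hx.1, by rw [hx.2]; exact neg_le_neg hεδ⟩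
  set CN := CH * (CA * (CB * (A ^ q * ENNReal.ofReal (4 * M₂ * b))))
  have hCN : CN ≠ ∞ := by
    have := ENNReal.rpow_ne_top_of_nonneg hq0.le hfin.ne
    finiteness
  refine (iSup₂_le (a := max (CN ^ (1 / q)) C') fun ε hεI => ?_).trans_lt
    (max_lt (ENNReal.rpow_lt_top_of_nonneg (by positivity) hCN) hC'.lt_top)
  rcases lt_or_ge ε δ with hlt | hge
  · refine le_max_of_le_left ?_
    rw [eLpNorm_eq_lintegral_rpow_enorm_toReal hp0 hp']
    gcongr
    exact hnear ε ⟨hεI, hlt⟩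
  · exact le_max_of_le_right (hfar ε ⟨hεI, hge⟩)

end Levels

theorem hardyNorm_lt_top_of_hardyNorm_lt_top {N : ℕ} (hN : 1 ≤ N)
    {D : Set (EuclideanSpace ℝ (Fin N))} (ho : IsOpen D) (hb : Bornology.IsBounded D)
    {lam₁ lam₂ : EuclideanSpace ℝ (Fin N) → ℝ}
    (h₁ : IsCharacterizing D lam₁) (h₂ : IsCharacterizing D lam₂) {ε₁ ε₂ : ℝ}
    (hε₁ : IsAdmissibleLevel D lam₁ ε₁) (hε₂ : IsAdmissibleLevel D lam₂ ε₂)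
    {p : ℝ≥0∞} (hp : 1 ≤ p) {u : EuclideanSpace ℝ (Fin N) → ℂ}
    (hu : InnerProductSpace.HarmonicOnNhd u D) (hfin : hardyNorm D lam₁ ε₁ p u < ∞) :
    hardyNorm D lam₂ ε₂ p u < ∞ := by
  -- With `N = m + 1` the truncated subtraction `N - 1` is `m`.
  obtain ⟨m, rfl⟩ := Nat.exists_eq_add_of_le' hN
  by_cases hp' : p = ∞
  · subst hp'
    exact hardyNorm_top_lt_top ho hb h₁ h₂ hε₁ hε₂ hu.continuousOn hfin
  · exact hardyNorm_lt_top_of_ne_top ho hb h₁ h₂ hε₁ hε₂ hu hp hp' hfin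

theorem lemma4p2 (N : ℕ) (hN : 2 ≤ N) (D : Set (EuclideanSpace ℝ (Fin N)))
    (hD_open : IsOpen D) (hD_conn : IsConnected D) (hD_bdd : Bornology.IsBounded D)
    (lam₁ lam₂ : EuclideanSpace ℝ (Fin N) → ℝ)
    (h₁ : IsCharacterizing D lam₁) (h₂ : IsCharacterizing D lam₂)
    (ε₁ ε₂ : ℝ) (hε₁ : IsAdmissibleLevel D lam₁ ε₁) (hε₂ : IsAdmissibleLevel D lam₂ ε₂)
    (p : ℝ≥0∞) (hp : 1 ≤ p) :
    (∀ u : EuclideanSpace ℝ (Fin N) → ℂ, InnerProductSpace.HarmonicOnNhd u D →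
      (hardyNorm D lam₁ ε₁ p u < ∞ ↔ hardyNorm D lam₂ ε₂ p u < ∞)) ∧
    harmonicHardySpace D lam₁ ε₁ p = harmonicHardySpace D lam₂ ε₂ p := by
  have key : ∀ u : EuclideanSpace ℝ (Fin N) → ℂ, InnerProductSpace.HarmonicOnNhd u D →
      (hardyNorm D lam₁ ε₁ p u < ∞ ↔ hardyNorm D lam₂ ε₂ p u < ∞) := fun u hu =>
    ⟨hardyNorm_lt_top_of_hardyNorm_lt_top (one_le_two.trans hN) hD_open hD_bdd h₁ h₂ hε₁ hε₂ hp hu,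
      hardyNorm_lt_top_of_hardyNorm_lt_top (one_le_two.trans hN) hD_open hD_bdd h₂ h₁ hε₂ hε₁ hp hu⟩
  exact ⟨key, Set.ext fun u => and_congr_right fun hu => key u hu⟩
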